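/- Let $\mathcal X,\mathcal Y,\mathcal Z$ be finite nonempty sets. A DM-MAC is a stochastic matrix $W:\mathcal X\times\mathcal Y\to\mathcal Z$, with $W^n(\mathbf z|\mathbf x,\mathbf y)=\prod_{t=1}^n W(z_t|x_t,y_t)$. An $(n,M_X,M_Y)$ code $\mathcal C$ consists of codewords $\mathbf x_i\in\mathcal X^n$ ($1\le i\le M_X$), $\mathbf y_j\in\mathcal Y^n$ ($1\le j\le M_Y$), not necessarily distinct, and pairwise disjoint decoding sets $D_{ij}\subseteq\mathcal Z^n$. Its average error probability is $$e(\mathcal C,W)=\frac1{M_XM_Y}\sum_{i,j}W^n(D_{ij}^c|\mathbf x_i,\mathbf y_j).$$ All logarithms and exponentials are natural. The sphere-packing exponent for the maximal error probability is $$E^m_{sp}(R_X,R_Y,W)=\sup_{P_{UXY}}\ \inf_{V}\ \sum_{x,y}P_{XY}(x,y)\,D\big(V(\cdot|x,y)\,\|\,W(\cdot|x,y)\big)\in[0,\infty],$$ where $D$ is relative entropy, the supremum is over all finite alphabets $\mathcal U$ and all distributions $P_{UXY}$ on $\mathcal U\times\mathcal X\times\mathcal Y$ for which $X-U-Y$ is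 a Markov chain, and the infimum is over all stochastic matrices $V:\mathcal X\times\mathcal Y\to\mathcal Z$ such that, for $(U,X,Y,Z)$ distributed according to $P_{UXY}(u,x,y)V(z|x,y)$, at least one of $$I(X\wedge Z\,|\,Y,U)\le R_X,\qquad I(Y\wedge Z\,|\,X,U)\le R_Y,\qquad I(XY\wedge Z\,|\,U)\le R_X+R_Y$$ holds. Theorem. For all finite nonempty $\mathcal X,\mathcal Y,\mathcal Z$ and all $R_X,R_Y,\delta>0$ there is $n_0$ such that, for every DM-MAC $W:\mathcal X\times\mathcal Y\to\mathcal Z$ and every $n\ge n_0$, every $(n,M_X,M_Y)$ code $\mathcal C$ with $$\frac1n\log M_X\ge R_X+\delta,\qquad \frac1n\log M_Y\ge R_Y+\delta$$ satisfies $$e(\mathcal C,W)\ \ge\ \tfrac12\exp\Big(-n\big(E^m_{sp}(R_X,R_Y,W)+\min\{R_X,R_Y\}\big)(1+\delta)\Big),$$ the right-hand side being $0$ when $E^m_{sp}(R_X,R_Y,W)=\infty$. -/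

import Mathlib

namespace MAC

noncomputable section

/-- `W` is a two-input channel with input alphabets `X`, `Y` and output alphabet `Z`, i.e. a
stochastic matrix: for all inputs `x`, `y`, the row `W x y` is a probability distribution on `Z`. -/
def IsChannel {X Y Z : Type*} [Fintype Z] (W : X → Y → Z → ℝ) : Prop :=
  ∀ x y, W x y ∈ stdSimplex ℝ Z

/-- The memoryless extension `W^n(z | x, y) = ∏ₜ W(zₜ | xₜ, yₜ)`. -/
def blockProb {X Y Z : Type*} {n : ℕ} (W : X → Y → Z → ℝ)
    (x : Fin n → X) (y : Fin n → Y) (z : Fin n → Z) : ℝ :=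
  ∏ t, W (x t) (y t) (z t)

/-- `W^n(B | x, y)` for a set `B` of output sequences. -/
def blockProbSet {X Y Z : Type*} [Fintype Z] {n : ℕ} (W : X → Y → Z → ℝ)
    (x : Fin n → X) (y : Fin n → Y) (B : Set (Fin n → Z)) : ℝ :=
  ∑ z, B.indicator (blockProb W x y) z

/-- An `(n, M, N)` multi-user code: codewords `xᵢ ∈ Xⁿ`, `yⱼ ∈ Yⁿ` (repetitions are allowed) and
pairwise disjoint decoding sets `Dᵢⱼ ⊆ Zⁿ`. -/
structure Code (X Y Z : Type*) (n M N : ℕ) where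
  cwX : Fin M → Fin n → X
  cwY : Fin N → Fin n → Y
  dec : Fin M → Fin N → Set (Fin n → Z)
  dec_disjoint : ∀ i j i' j', (i, j) ≠ (i', j') → Disjoint (dec i j) (dec i' j')

/-- The average error probability of a code for the channel `W`. -/
def Code.avgError {X Y Z : Type*} [Fintype Z] {n M N : ℕ} (C : Code X Y Z n M N)
    (W : X → Y → Z → ℝ) : ℝ :=
  1 / ((M : ℝ) * (N : ℝ)) *
    ∑ i, ∑ j, blockProbSet W (C.cwX i) (C.cwY j) (C.dec i j)ᶜ

open Classical in
/-- The relative entropy `D(P ‖ Q) = ∑ₐ P(a) log (P(a) / Q(a))` (natural logarithm) of two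
probability distributions on a finite set; it is `∞` when `P` charges a point that `Q` does not. -/
def relEntropy {A : Type*} [Fintype A] (P Q : A → ℝ) : ENNReal :=
  if ∀ a, Q a = 0 → P a = 0 then ENNReal.ofReal (∑ a, P a * Real.log (P a / Q a)) else ⊤

/-- The conditional divergence `D(V ‖ W | P_XY) = ∑ P_XY(x, y) D(V(· | x, y) ‖ W(· | x, y))`. -/
def condDivergence {X Y Z : Type*} [Fintype X] [Fintype Y] [Fintype Z]
    (V W : X → Y → Z → ℝ) (P : X → Y → ℝ) : ENNReal :=
  ∑ x, ∑ y, ENNReal.ofReal (P x y) * relEntropy (V x y) (W x y)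

/-- The conditional mutual information `I(A ∧ B | C)` (in nats) of a triple of finite random
variables with joint probability mass function `q`. -/
def condMutualInfo {A B C : Type*} [Fintype A] [Fintype B] [Fintype C]
    (q : A → B → C → ℝ) : ℝ :=
  ∑ a, ∑ b, ∑ c, q a b c *
    Real.log ((q a b c * ∑ a', ∑ b', q a' b' c) / ((∑ b', q a b' c) * ∑ a', q a' b c))

/-- The Markov chain condition `X - U - Y` for a joint distribution `P_UXY`:
`P(u, x, y) P(u) = P(u, x) P(u, y)`. -/
def IsMarkov {U X Y : Type*} [Fintype X] [Fintype Y] (P : U × X × Y → ℝ) : Prop :=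
  ∀ u x y, P (u, x, y) * ∑ x', ∑ y', P (u, x', y') =
    (∑ y', P (u, x, y')) * ∑ x', P (u, x', y)

/-- `V_{Z|XY}` satisfies at least one of
`I_V(X ∧ Z | Y U) ≤ R_X`, `I_V(Y ∧ Z | X U) ≤ R_Y`, `I_V(X Y ∧ Z | U) ≤ R_X + R_Y`, the joint
distribution of `(U, X, Y, Z)` being `P(u, x, y) V(z | x, y)`. -/
def MeetsRateCondition {U X Y Z : Type*} [Fintype U] [Fintype X] [Fintype Y] [Fintype Z]
    (RX RY : ℝ) (P : U × X × Y → ℝ) (V : X → Y → Z → ℝ) : Prop :=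
  condMutualInfo (fun (x : X) (z : Z) (c : Y × U) => P (c.2, x, c.1) * V x c.1 z) ≤ RX ∨
  condMutualInfo (fun (y : Y) (z : Z) (c : X × U) => P (c.2, c.1, y) * V c.1 y z) ≤ RY ∨
  condMutualInfo (fun (a : X × Y) (z : Z) (u : U) => P (u, a.1, a.2) * V a.1 a.2 z) ≤ RX + RY

/-- The sphere-packing exponent for the maximal error probability,
`E^m_sp(R_X, R_Y, W) = max_{P_UXY : X - U - Y} min_{V_{Z|XY}} D(V ‖ W | P_XY)`, the minimum being
over the channels `V` that satisfy `MeetsRateCondition RX RY P V`, and `U` ranging over all finite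
alphabets (of arbitrary size). The value may be `∞`. -/
def maxErrorSpherePackingExponent {X Y Z : Type*} [Fintype X] [Fintype Y] [Fintype Z]
    (RX RY : ℝ) (W : X → Y → Z → ℝ) : ENNReal :=
  ⨆ (k : ℕ) (P : Fin k × X × Y → ℝ) (_ : P ∈ stdSimplex ℝ (Fin k × X × Y)) (_ : IsMarkov P),
    ⨅ (V : X → Y → Z → ℝ) (_ : IsChannel V) (_ : MeetsRateCondition RX RY P V),
      condDivergence V W (fun x y => ∑ u, P (u, x, y))

end

end MAC

namespace MAC

open Finset Filter

/-! The bound is proved for the maximal error and passed to the average error by counting.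

Maximal error. Suppose that every pair of codewords has error well below the claimed bound. Single
pairs may have any joint type, but most pairs of a full rectangle look conditionally independent. As
in the regularity lemma, refine a time-sharing sequence `u` by a `y`-codeword as long as this raises
the average of `P(x|u)` along the `x`-codewords noticeably. This quantity is at most 1, so the
process stops with a bounded alphabet, and then most joint types with `u` are close to Markov chains
(`sq_sum_abs_emp_sub_markovProd_le`, `exists_refinement`). Pigeonholing over types leaves a
polynomial fraction of the pairs with one common type (`exists_common_type`).

The exponent, evaluated at the Markov chain near this type, supplies a test channel `V` that is
close to `W` in divergence and violates one of the three rate requirements (`exists_test_channel`).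
Closeness and tiny errors under `W` force a success probability bounded below under `V`
(`mul_prob_le_sum_kl_add_log_two`). The strong converse (`card_mul_le_exp`), applied for a fixed
`y`-codeword, a fixed `x`-codeword, or all pairs at once, shows that there are too many pairs for
this (`exists_exp_le_blockProbSet_compl`).

Average error. Hence every subcode of rates slightly above `RX`, `RY` contains a bad pair. Given `a`
rows, all but few columns meet a bad entry in these rows, so a fraction of about `1/a` of all
entries is bad (`div_mul_mul_le_sum_sum`). Taking as rows the codewords of the user with the smaller
rate gives the loss `min RX RY`. -/

/-- The relative entropy `∑ z, v z * log (v z / q z)` as a real number. -/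
noncomputable def kl {Z : Type*} [Fintype Z] (v q : Z → ℝ) : ℝ :=
  ∑ z, v z * Real.log (v z / q z)

/-! ### Change of measure and the strong converse for product distributions. -/

section Product

variable {Z : Type*} [Fintype Z] {n : ℕ}

theorem sum_prod_apply (f : Fin n → Z → ℝ) : ∑ z : Fin n → Z, ∏ t, f t (z t) = ∏ t, ∑ a, f t a := by
  rw [Finset.prod_univ_sum, Fintype.piFinset_univ]

theorem sum_prod_apply_eq_one {V : Fin n → Z → ℝ} (hV : ∀ t, ∑ a, V t a = 1) :
    ∑ z : Fin n → Z, ∏ t, V t (z t) = 1 := by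
  rw [sum_prod_apply]; simp [hV]

/-- The expectation of an additive functional under a product distribution. -/
theorem sum_prod_mul_sum {V : Fin n → Z → ℝ} (hV : ∀ t, ∑ a, V t a = 1) (f : Fin n → Z → ℝ) :
    ∑ z : Fin n → Z, (∏ t, V t (z t)) * ∑ t, f t (z t) = ∑ t, ∑ a, V t a * f t a := by
  classical
  simp_rw [Finset.mul_sum]
  rw [Finset.sum_comm]
  refine Finset.sum_congr rfl fun t _ => ?_
  have h : ∀ z : Fin n → Z, (∏ s, V s (z s)) * f t (z t)
      = ∏ s, (if s = t then V s (z s) * f s (z s) else V s (z s)) := by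
    intro z
    rw [← Finset.mul_prod_erase univ _ (mem_univ t),
      ← Finset.mul_prod_erase univ (fun s => if s = t then _ else _) (mem_univ t)]
    rw [Finset.prod_congr rfl (g := fun s => V s (z s))
      (fun s hs => if_neg (Finset.ne_of_mem_erase hs))]
    simp only [if_true]
    ring
  simp_rw [h]
  rw [sum_prod_apply (fun s a => if s = t then V s a * f s a else V s a)]
  rw [← Finset.mul_prod_erase univ _ (mem_univ t)]
  rw [Finset.prod_congr rfl (g := fun _ => (1 : ℝ))
    (fun s hs => by simp [Finset.ne_of_mem_erase hs, hV])]
  simp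

theorem log_prod_div_prod {Z : Type*} {n : ℕ} {V Q : Fin n → Z → ℝ} {z : Fin n → Z}
    (hV : ∀ t, 0 < V t (z t)) (hQ : ∀ t, 0 < Q t (z t)) :
    Real.log ((∏ t, V t (z t)) / ∏ t, Q t (z t)) = ∑ t, Real.log (V t (z t) / Q t (z t)) := by
  rw [← Finset.prod_div_distrib, Real.log_prod fun t _ => (div_pos (hV t) (hQ t)).ne']

/-- Gibbs' inequality. -/
theorem kl_nonneg {v q : Z → ℝ} (hv : ∀ z, 0 ≤ v z) (hq : ∀ z, 0 ≤ q z) (hv1 : ∑ z, v z = 1)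
    (hq1 : ∑ z, q z ≤ 1) (hac : ∀ z, q z = 0 → v z = 0) : 0 ≤ kl v q := by
  have h : ∀ z, v z - q z ≤ v z * Real.log (v z / q z) := by
    intro z
    rcases (hv z).eq_or_lt with h0 | h0
    · simp [← h0, hq z]
    · have hq0 : 0 < q z := lt_of_le_of_ne (hq z) fun h => h0.ne' (hac z h.symm)
      have := Real.log_le_sub_one_of_pos (div_pos hq0 h0)
      have h2 : Real.log (v z / q z) = - Real.log (q z / v z) := by
        rw [← Real.log_inv, inv_div]
      rw [h2]
      have h3 : v z * Real.log (q z / v z) ≤ v z * (q z / v z - 1) :=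
        mul_le_mul_of_nonneg_left this h0.le
      have h4 : v z * (q z / v z - 1) = q z - v z := by field_simp
      linarith
  have := Finset.sum_le_sum fun z (_ : z ∈ univ) => h z
  rw [Finset.sum_sub_distrib] at this
  unfold kl
  linarith

/-- If `S` has probability at most `exp (-a)` under `W`, then `a` times its probability under `V` is
at most the relative entropy plus `log 2`. -/
theorem mul_prob_le_sum_kl_add_log_two {V W : Fin n → Z → ℝ} (hV : ∀ t, V t ∈ stdSimplex ℝ Z)
    (hW : ∀ t, W t ∈ stdSimplex ℝ Z) (hac : ∀ t a, W t a = 0 → V t a = 0) (S : Set (Fin n → Z))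
    {a : ℝ} (hS : (∑ z, S.indicator (fun z => ∏ t, W t (z t)) z) * Real.exp a ≤ 1) :
    a * ∑ z, S.indicator (fun z => ∏ t, V t (z t)) z ≤ ∑ t, kl (V t) (W t) + Real.log 2 := by
  classical
  have hpos : ∀ z : Fin n → Z, 0 ≤ ∏ t, V t (z t) := fun z => prod_nonneg fun t _ => (hV t).1 _
  have hWpos : ∀ z : Fin n → Z, 0 ≤ ∏ t, W t (z t) := fun z => prod_nonneg fun t _ => (hW t).1 _
  have key : ∀ z : Fin n → Z,
      a * S.indicator (fun z => ∏ t, V t (z t)) z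
        - (∏ t, V t (z t)) * ∑ t, Real.log (V t (z t) / W t (z t))
        - Real.log 2 * (∏ t, V t (z t))
      ≤ ((∏ t, W t (z t)) + Real.exp a * S.indicator (fun z => ∏ t, W t (z t)) z) / 2
        - ∏ t, V t (z t) := by
    intro z
    have hi : 0 ≤ S.indicator (fun z => ∏ t, W t (z t)) z :=
      Set.indicator_nonneg (fun z _ => hWpos z) z
    rcases (hpos z).eq_or_lt with h0 | h0
    · have : S.indicator (fun z => ∏ t, V t (z t)) z = 0 := by
        by_cases hz : z ∈ S <;> simp [hz, ← h0]
      rw [this, ← h0]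
      have := hWpos z
      have := mul_nonneg (Real.exp_pos a).le hi
      simp
      linarith
    · have hVt : ∀ t, 0 < V t (z t) := fun t => lt_of_le_of_ne ((hV t).1 _)
        fun h => h0.ne' (prod_eq_zero (mem_univ t) h.symm)
      have hWt : ∀ t, 0 < W t (z t) := fun t => lt_of_le_of_ne ((hW t).1 _)
        fun h => (hVt t).ne' (hac t _ h.symm)
      have hW0 : 0 < ∏ t, W t (z t) := prod_pos fun t _ => hWt t
      rw [← log_prod_div_prod hVt hWt]
      set p := ∏ t, V t (z t)
      set q := ∏ t, W t (z t)
      -- Donsker–Varadhan inequality with the test function `a` times the indicator of `S`. Its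
      -- exponential moment under `W` is at most `1 + exp a * W(S) ≤ 2`; normalising by this 2
      -- produces the term `log 2`.
      set b : ℝ := if z ∈ S then a else 0
      have hb : a * S.indicator (fun z => ∏ t, V t (z t)) z = p * b := by
        by_cases hz : z ∈ S <;> simp [b, hz, p, mul_comm]
      have hq : q * Real.exp b ≤ q + Real.exp a * S.indicator (fun z => ∏ t, W t (z t)) z := by
        by_cases hz : z ∈ S
        · simp only [b, hz, if_true, Set.indicator_of_mem]
          change q * Real.exp a ≤ q + Real.exp a * q
          linarith
        · simp [b, hz]
      have h1 := Real.log_le_sub_one_of_pos (x := q * Real.exp b / (2 * p)) (by positivity)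
      rw [Real.log_div (by positivity) (by positivity), Real.log_mul hW0.ne' (by positivity),
        Real.log_exp, Real.log_mul (by norm_num) h0.ne'] at h1
      have h2 := mul_le_mul_of_nonneg_left h1 h0.le
      have h3 : p * (q * Real.exp b / (2 * p) - 1) = q * Real.exp b / 2 - p := by field_simp
      rw [hb, Real.log_div h0.ne' hW0.ne']
      linarith
  have hsum := Finset.sum_le_sum fun z (_ : z ∈ univ) => key z
  simp only [Finset.sum_sub_distrib, ← Finset.mul_sum, ← Finset.sum_div,
    Finset.sum_add_distrib] at hsum
  rw [sum_prod_mul_sum (fun t => (hV t).2) (fun t a => Real.log (V t a / W t a)),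
    sum_prod_apply_eq_one (fun t => (hV t).2), sum_prod_apply_eq_one (fun t => (hW t).2)] at hsum
  unfold kl
  linarith

theorem exp_le_one_add_add_sq {x : ℝ} (hx : x ≤ 1) : Real.exp x ≤ 1 + x + x ^ 2 := by
  rcases le_total (-1) x with h | h
  · have := Real.abs_exp_sub_one_sub_id_le (abs_le.2 ⟨h, hx⟩)
    linarith [le_abs_self (Real.exp x - 1 - x)]
  · have : Real.exp x ≤ 1 := Real.exp_le_one_iff.2 (by linarith)
    nlinarith

/-- Only an upper bound on the ratio is needed. Where `r = v / q` is below 1, the weight is `v = q *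
r`, and `r * log r ^ 2 ≤ 4` because `-log r ≤ 2 / √r`. This second-moment bound is uniform in `v`,
hence later uniform in the channel. -/
theorem mul_log_div_sq_le {v q L : ℝ} (hv : 0 ≤ v) (hv1 : v ≤ 1) (hq : 0 < q) (hq1 : q ≤ 1)
    (hle : v / q ≤ Real.exp L) : v * Real.log (v / q) ^ 2 ≤ 4 + L ^ 2 := by
  rcases hv.eq_or_lt with h0 | h0
  · rw [← h0]; simp; positivity
  have hr : 0 < v / q := div_pos h0 hq
  rcases le_total 1 (v / q) with h | h
  · have h1 : 0 ≤ Real.log (v / q) := Real.log_nonneg h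
    have h2 : Real.log (v / q) ≤ L := (Real.log_le_iff_le_exp hr).2 hle
    have h3 : Real.log (v / q) ^ 2 ≤ L ^ 2 := pow_le_pow_left₀ h1 h2 2
    nlinarith [sq_nonneg (Real.log (v / q))]
  · set r := v / q
    have hv' : v = q * r := by simp only [r]; field_simp
    have hs : 0 < Real.sqrt r := Real.sqrt_pos.2 hr
    have h1 : -Real.log r ≤ 2 * (Real.sqrt r)⁻¹ := by
      have := Real.log_le_sub_one_of_pos (inv_pos.2 hs)
      rw [Real.log_inv, Real.log_sqrt hr.le] at this
      linarith
    have h2 : 0 ≤ -Real.log r := by linarith [Real.log_nonpos hr.le h]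
    have h3 : Real.log r ^ 2 ≤ 4 * r⁻¹ := by
      have := pow_le_pow_left₀ h2 h1 2
      rw [mul_pow, inv_pow, Real.sq_sqrt hr.le] at this
      nlinarith
    have h4 : r * Real.log r ^ 2 ≤ 4 := by
      have := mul_le_mul_of_nonneg_left h3 hr.le
      rwa [mul_left_comm, mul_inv_cancel₀ hr.ne', mul_one] at this
    rw [hv', mul_assoc]
    nlinarith [mul_nonneg hr.le (sq_nonneg (Real.log r)), sq_nonneg L]

/-- A bound on the exponential moment of the log-likelihood ratio. -/
theorem sum_mul_exp_log_div_le {v q : Z → ℝ} (hv : v ∈ stdSimplex ℝ Z) (hq : ∀ z, 0 < q z)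
    (hq1 : ∀ z, q z ≤ 1) {L s : ℝ} (hle : ∀ z, v z / q z ≤ Real.exp L) (hs : 0 ≤ s)
    (hsL : s * L ≤ 1) :
    ∑ z, v z * Real.exp (s * Real.log (v z / q z))
      ≤ Real.exp (s * kl v q + s ^ 2 * (Fintype.card Z * (4 + L ^ 2))) := by
  have hv1 : ∀ z, v z ≤ 1 := fun z => by
    rw [← hv.2]; exact single_le_sum (fun a _ => hv.1 a) (mem_univ z)
  have h : ∀ z, v z * Real.exp (s * Real.log (v z / q z))
      ≤ v z + s * (v z * Real.log (v z / q z)) + s ^ 2 * (4 + L ^ 2) := by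
    intro z
    rcases (hv.1 z).eq_or_lt with h0 | h0
    · rw [← h0]; simp; positivity
    have hl : Real.log (v z / q z) ≤ L := (Real.log_le_iff_le_exp (div_pos h0 (hq z))).2 (hle z)
    have h1 := exp_le_one_add_add_sq (x := s * Real.log (v z / q z))
      ((mul_le_mul_of_nonneg_left hl hs).trans hsL)
    have h2 := mul_le_mul_of_nonneg_left h1 h0.le
    have h3 := mul_le_mul_of_nonneg_left
      (mul_log_div_sq_le h0.le (hv1 z) (hq z) (hq1 z) (hle z)) (sq_nonneg s)
    nlinarith
  refine (Finset.sum_le_sum fun z _ => h z).trans ?_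
  rw [Finset.sum_add_distrib, Finset.sum_add_distrib, ← Finset.mul_sum, hv.2]
  simp only [sum_const, card_univ, nsmul_eq_mul]
  refine le_trans (le_of_eq ?_) (Real.add_one_le_exp _)
  unfold kl
  ring

/-- An upper bound for the probability of a set under `V` in terms of its probability under `Q`. -/
theorem prob_le_exp_mul_add {V Q : Fin n → Z → ℝ} (hV : ∀ t, V t ∈ stdSimplex ℝ Z)
    (hQ : ∀ t z, 0 < Q t z) (hQ1 : ∀ t z, Q t z ≤ 1) {L s : ℝ}
    (hle : ∀ t z, V t z / Q t z ≤ Real.exp L) (hs : 0 ≤ s) (hsL : s * L ≤ 1)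
    (S : Set (Fin n → Z)) (κ : ℝ) :
    ∑ z, S.indicator (fun z => ∏ t, V t (z t)) z
      ≤ Real.exp κ * ∑ z, S.indicator (fun z => ∏ t, Q t (z t)) z
        + Real.exp (s * (∑ t, kl (V t) (Q t) - κ) + n * (s ^ 2 * (Fintype.card Z * (4 + L ^ 2)))) := by
  classical
  have hpos : ∀ z : Fin n → Z, 0 ≤ ∏ t, V t (z t) := fun z => prod_nonneg fun t _ => (hV t).1 _
  have key : ∀ z : Fin n → Z, S.indicator (fun z => ∏ t, V t (z t)) z
      ≤ Real.exp κ * S.indicator (fun z => ∏ t, Q t (z t)) z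
        + Real.exp (-(s * κ)) * ∏ t, (V t (z t) * Real.exp (s * Real.log (V t (z t) / Q t (z t)))) := by
    intro z
    have hr : 0 ≤ Real.exp (-(s * κ)) *
        ∏ t, (V t (z t) * Real.exp (s * Real.log (V t (z t) / Q t (z t)))) :=
      mul_nonneg (Real.exp_pos _).le
        (prod_nonneg fun t _ => mul_nonneg ((hV t).1 _) (Real.exp_pos _).le)
    by_cases hz : z ∈ S
    swap
    · simpa [hz] using hr
    simp only [hz, Set.indicator_of_mem]
    have hq0 : 0 < ∏ t, Q t (z t) := prod_pos fun t _ => hQ t _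
    rcases (hpos z).eq_or_lt with h0 | h0
    · rw [← h0]
      positivity
    have hVt : ∀ t, 0 < V t (z t) := fun t => lt_of_le_of_ne ((hV t).1 _)
        fun h => h0.ne' (prod_eq_zero (mem_univ t) h.symm)
    rw [prod_mul_distrib, ← Real.exp_sum, ← mul_sum, ← log_prod_div_prod hVt (fun t => hQ t _)] at hr ⊢
    set p := ∏ t, V t (z t)
    set q := ∏ t, Q t (z t)
    -- Either the likelihood ratio is at most `exp κ` and the first term dominates, or it is larger
    -- and the Chernoff weight with parameter `s` is at least 1.
    rcases le_total p (Real.exp κ * q) with h | h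
    · linarith
    · have h1 : κ ≤ Real.log (p / q) := by
        rw [Real.le_log_iff_exp_le (div_pos h0 hq0), le_div_iff₀ hq0]; exact h
      have h2 : 1 ≤ Real.exp (-(s * κ)) * Real.exp (s * Real.log (p / q)) := by
        rw [← Real.exp_add]
        exact Real.one_le_exp (by nlinarith)
      have h3 : 0 ≤ Real.exp κ * q := by positivity
      nlinarith
  refine (Finset.sum_le_sum fun z _ => key z).trans ?_
  rw [Finset.sum_add_distrib, ← mul_sum, ← mul_sum]
  refine add_le_add le_rfl ?_
  rw [sum_prod_apply (fun t a => V t a * Real.exp (s * Real.log (V t a / Q t a)))]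
  have h : ∏ t, ∑ a, V t a * Real.exp (s * Real.log (V t a / Q t a))
      ≤ Real.exp (s * ∑ t, kl (V t) (Q t) + n * (s ^ 2 * (Fintype.card Z * (4 + L ^ 2)))) := by
    refine (prod_le_prod (fun t _ => sum_nonneg fun a _ =>
      mul_nonneg ((hV t).1 _) (Real.exp_pos _).le) fun t _ =>
      sum_mul_exp_log_div_le (hV t) (hQ t) (hQ1 t) (hle t) hs hsL).trans ?_
    rw [← Real.exp_sum, sum_add_distrib, ← mul_sum]
    simp
  refine (mul_le_mul_of_nonneg_left h (Real.exp_pos _).le).trans (le_of_eq ?_)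
  rw [← Real.exp_add]
  congr 1
  ring

/-- The strong converse: disjoint decoding sets with success probability at least `ε`, tested
against a common product distribution. -/
theorem card_mul_le_exp {ι : Type*} (G : Finset ι) (V : ι → Fin n → Z → ℝ)
    {Q : Fin n → Z → ℝ} (hV : ∀ i ∈ G, ∀ t, V i t ∈ stdSimplex ℝ Z) (hQ : ∀ t z, 0 < Q t z)
    (hQ1 : ∀ t, ∑ z, Q t z ≤ 1) {L s : ℝ}
    (hle : ∀ i ∈ G, ∀ t z, V i t z / Q t z ≤ Real.exp L) (hs : 0 ≤ s) (hsL : s * L ≤ 1)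
    (D : ι → Set (Fin n → Z)) (hD : ∀ i ∈ G, ∀ j ∈ G, i ≠ j → Disjoint (D i) (D j)) {κ γ ε : ℝ}
    (hκ : ∀ i ∈ G, ∑ t, kl (V i t) (Q t) ≤ κ)
    (hε : ∀ i ∈ G, ε ≤ ∑ z, (D i).indicator (fun z => ∏ t, V i t (z t)) z)
    (hsmall : Real.exp (-(s * (n * γ)) + n * (s ^ 2 * (Fintype.card Z * (4 + L ^ 2)))) ≤ ε / 2) :
    #G * (ε / 2) ≤ Real.exp (κ + n * γ) := by
  classical
  have hQle : ∀ t z, Q t z ≤ 1 := fun t z =>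
    (single_le_sum (fun a _ => (hQ t a).le) (mem_univ z)).trans (hQ1 t)
  have hq : ∀ i ∈ G, ε / 2 ≤ Real.exp (κ + n * γ) *
      ∑ z, (D i).indicator (fun z => ∏ t, Q t (z t)) z := by
    intro i hi
    have h := prob_le_exp_mul_add (hV i hi) hQ hQle (hle i hi) hs hsL (D i) (κ + n * γ)
    have h2 : Real.exp (s * (∑ t, kl (V i t) (Q t) - (κ + n * γ)) +
        n * (s ^ 2 * (Fintype.card Z * (4 + L ^ 2)))) ≤ ε / 2 := by
      refine (Real.exp_le_exp.2 ?_).trans hsmall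
      have := mul_le_mul_of_nonneg_left (hκ i hi) hs
      nlinarith
    linarith [hε i hi]
  -- Each `D i` has `Q`-probability at least `exp (-(κ + n * γ)) * ε / 2`; disjointness bounds the
  -- sum of these probabilities by 1, which limits their number.
  have hsum : ∑ i ∈ G, ∑ z, (D i).indicator (fun z => ∏ t, Q t (z t)) z ≤ 1 := by
    rw [sum_comm]
    have hle1 : ∀ z : Fin n → Z, ∑ i ∈ G, (D i).indicator (fun z => ∏ t, Q t (z t)) z
        ≤ ∏ t, Q t (z t) := by
      intro z
      have h0 : 0 ≤ ∏ t, Q t (z t) := prod_nonneg fun t _ => (hQ t _).le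
      by_cases hz : ∃ i ∈ G, z ∈ D i
      · obtain ⟨i, hi, hzi⟩ := hz
        rw [sum_eq_single_of_mem i hi]
        · simp [hzi]
        · intro j hj hji
          exact Set.indicator_of_notMem (Set.disjoint_left.1 (hD i hi j hj hji.symm) hzi) _
      · push Not at hz
        rw [sum_eq_zero fun i hi => Set.indicator_of_notMem (hz i hi) _]
        exact h0
    refine (sum_le_sum fun z _ => hle1 z).trans ?_
    rw [sum_prod_apply]
    exact prod_le_one (fun t _ => sum_nonneg fun a _ => (hQ t a).le) fun t _ => hQ1 t
  have h := sum_le_sum hq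
  rw [← mul_sum, sum_const, nsmul_eq_mul] at h
  refine h.trans ?_
  have := Real.exp_pos (κ + n * γ)
  nlinarith

end Product

/-! ### Types of sequences and the energy of a codeword relative to a time-sharing sequence. -/

section Empirical

open Classical in
/-- The empirical distribution (type) of a finite sequence. -/
noncomputable def emp {A : Type*} {n : ℕ} (w : Fin n → A) (a : A) : ℝ :=
  #{t | w t = a} / (n : ℝ)

variable {A B : Type*} {n : ℕ}

open Classical in
theorem emp_eq_sum (w : Fin n → A) (a : A) :
    emp w a = (∑ t, if w t = a then (1 : ℝ) else 0) / n := by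
  simp [emp]

theorem emp_nonneg (w : Fin n → A) (a : A) : 0 ≤ emp w a := by
  unfold emp; positivity

theorem sum_emp_mul [Fintype A] (w : Fin n → A) (f : A → ℝ) :
    ∑ a, emp w a * f a = (∑ t, f (w t)) / n := by
  classical
  simp_rw [emp_eq_sum, div_mul_eq_mul_div, sum_mul, ← sum_div]
  rw [sum_comm]
  simp

theorem sum_emp [Fintype A] (hn : n ≠ 0) (w : Fin n → A) : ∑ a, emp w a = 1 := by
  have := sum_emp_mul w (fun _ => 1)
  simp_all

/-- An inequality only, because for `n = 0` division by zero makes `emp w` vanish. -/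
theorem sum_emp_le_one [Fintype A] (w : Fin n → A) : ∑ a, emp w a ≤ 1 := by
  have := sum_emp_mul w (fun _ => 1)
  simp only [mul_one, sum_const, card_univ, Fintype.card_fin, nsmul_eq_mul] at this
  rw [this]
  exact div_self_le_one _

theorem sum_emp_snd [Fintype B] (w : Fin n → A) (v : Fin n → B) (a : A) :
    ∑ b, emp (fun t => (w t, v t)) (a, b) = emp w a := by
  classical
  simp_rw [emp_eq_sum, ← sum_div, Prod.mk.injEq]
  rw [sum_comm]
  congr 1
  refine sum_congr rfl fun t _ => ?_
  by_cases h : w t = a <;> simp [h]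

theorem emp_comp {f : A → B} (hf : Function.Injective f) (w : Fin n → A) (a : A) :
    emp (fun t => f (w t)) (f a) = emp w a := by
  classical
  simp [emp_eq_sum, hf.eq_iff]

variable {U X Y : Type*}

/-- The mean square of the conditional empirical distribution of `x` given `u`. -/
noncomputable def energy (x : Fin n → X) (u : Fin n → U) : ℝ :=
  (∑ t, emp (fun s => (u s, x s)) (u t, x t) / emp u (u t)) / n

theorem energy_nonneg (x : Fin n → X) (u : Fin n → U) : 0 ≤ energy x u :=
  div_nonneg (sum_nonneg fun _ _ => div_nonneg (emp_nonneg _ _) (emp_nonneg _ _)) n.cast_nonneg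

theorem emp_prod_le (u : Fin n → U) (x : Fin n → X) (a : U) (b : X) :
    emp (fun s => (u s, x s)) (a, b) ≤ emp u a := by
  classical
  unfold emp
  gcongr with t
  simp only [Prod.mk.injEq]
  exact fun h => h.1

theorem energy_le_one (x : Fin n → X) (u : Fin n → U) : energy x u ≤ 1 := by
  unfold energy
  refine div_le_one_of_le₀ ?_ n.cast_nonneg
  refine (sum_le_sum (g := fun _ => (1 : ℝ)) fun t _ => ?_).trans (by simp)
  exact div_le_one_of_le₀ (emp_prod_le _ _ _ _) (emp_nonneg _ _)

theorem energy_comp {V : Type*} {f : U → V} (hf : Function.Injective f) (x : Fin n → X)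
    (u : Fin n → U) : energy x (fun t => f (u t)) = energy x u := by
  unfold energy
  have h : ∀ t, emp (fun s => (f (u s), x s)) (f (u t), x t) = emp (fun s => (u s, x s)) (u t, x t) :=
    fun t => emp_comp (f := fun p : U × X => (f p.1, p.2))
      (fun p q h => by simp only [Prod.mk.injEq] at h; exact Prod.ext (hf h.1) h.2)
      (fun s => (u s, x s)) (u t, x t)
  simp_rw [h, emp_comp hf]

theorem energy_eq_sum [Fintype U] [Fintype X] (x : Fin n → X) (u : Fin n → U) :
    energy x u = ∑ a, ∑ b, emp (fun s => (u s, x s)) (a, b) ^ 2 / emp u a := by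
  rw [energy, ← sum_emp_mul (fun t => (u t, x t))
    (fun p => emp (fun s => (u s, x s)) (p.1, p.2) / emp u p.1), Fintype.sum_prod_type]
  refine sum_congr rfl fun a _ => sum_congr rfl fun b _ => ?_
  ring

end Empirical

/-! ### Energy increment and joint types close to Markov chains. -/

/-- The increment of the mean square conditional probability of `x` under the refinement of `u` by
`y` controls the distance to conditional independence. -/
theorem sq_sum_abs_sub_le {U X Y : Type*} [Fintype U] [Fintype X] [Fintype Y] (N : U → X → Y → ℝ)
    (hN : ∀ u x y, 0 ≤ N u x y) (hN1 : ∑ u, ∑ x, ∑ y, N u x y ≤ 1) :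
    (∑ u, ∑ x, ∑ y, |N u x y - (∑ y', N u x y') * (∑ x', N u x' y) / ∑ x', ∑ y', N u x' y'|) ^ 2
      ≤ Fintype.card X * (∑ u, ∑ x, ∑ y, N u x y ^ 2 / ∑ x', N u x' y
        - ∑ u, ∑ x, (∑ y, N u x y) ^ 2 / ∑ x', ∑ y', N u x' y') := by
  set A : U → X → ℝ := fun u x => ∑ y, N u x y with hA
  set B : U → Y → ℝ := fun u y => ∑ x, N u x y with hB
  set C : U → ℝ := fun u => ∑ x, ∑ y, N u x y with hC
  have hB0 : ∀ u y, 0 ≤ B u y := fun u y => sum_nonneg fun x _ => hN u x y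
  have hNB : ∀ u x y, B u y = 0 → N u x y = 0 := fun u x y h =>
    (sum_eq_zero_iff_of_nonneg fun x _ => hN u x y).1 h x (mem_univ x)
  have hCB : ∀ u, ∑ y, B u y = C u := fun u => sum_comm
  change (∑ u, ∑ x, ∑ y, |N u x y - A u x * B u y / C u|) ^ 2 ≤ Fintype.card X *
    (∑ u, ∑ x, ∑ y, N u x y ^ 2 / B u y - ∑ u, ∑ x, A u x ^ 2 / C u)
  have hexp : ∀ u x y, (N u x y - A u x * B u y / C u) ^ 2 / B u y
      = N u x y ^ 2 / B u y - 2 * (A u x / C u) * N u x y + (A u x / C u) ^ 2 * B u y := by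
    intro u x y
    rcases eq_or_ne (B u y) 0 with h | h
    · simp [h, hNB u x y h]
    · field_simp
      ring
  -- Pythagoras: `P(x|u)` is the conditional mean of `P(x|u,y)`, so the increment is exactly the
  -- variance of `P(x|u,y)` about it.
  have hinc : ∑ u, ∑ x, ∑ y, (N u x y - A u x * B u y / C u) ^ 2 / B u y
      = ∑ u, ∑ x, ∑ y, N u x y ^ 2 / B u y - ∑ u, ∑ x, A u x ^ 2 / C u := by
    rw [← sum_sub_distrib]
    refine sum_congr rfl fun u _ => ?_
    rw [← sum_sub_distrib]
    refine sum_congr rfl fun x _ => ?_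
    simp_rw [hexp]
    rw [sum_add_distrib, sum_sub_distrib, ← mul_sum, ← mul_sum, hCB]
    change _ - 2 * (A u x / C u) * A u x + _ = _
    rcases eq_or_ne (C u) 0 with h | h
    · simp [h]
    · field_simp
      ring
  rw [← hinc]
  -- Cauchy–Schwarz with weights `B u y`. They do not depend on `x`, so their sum over all triples
  -- is at most the number of letters in `X`.
  have hcs := sum_sq_le_sum_mul_sum_of_sq_le_mul (univ : Finset (U × X × Y))
    (r := fun p => |N p.1 p.2.1 p.2.2 - A p.1 p.2.1 * B p.1 p.2.2 / C p.1|)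
    (f := fun p => B p.1 p.2.2)
    (g := fun p => (N p.1 p.2.1 p.2.2 - A p.1 p.2.1 * B p.1 p.2.2 / C p.1) ^ 2 / B p.1 p.2.2)
    (fun p _ => hB0 _ _) (fun p _ => div_nonneg (sq_nonneg _) (hB0 _ _)) (fun p _ => by
      refine le_of_eq ?_
      rw [sq_abs]
      rcases eq_or_ne (B p.1 p.2.2) 0 with h | h
      · simp [h, hNB _ p.2.1 _ h]
      · field_simp)
  simp only [Fintype.sum_prod_type] at hcs
  refine hcs.trans ?_
  refine mul_le_mul_of_nonneg_right ?_ (sum_nonneg fun u _ => sum_nonneg fun x _ =>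
    sum_nonneg fun y _ => div_nonneg (sq_nonneg _) (hB0 _ _))
  simp_rw [hCB]
  rw [sum_comm]
  simp only [sum_const, card_univ, nsmul_eq_mul]
  have : ∑ u, C u ≤ 1 := hN1
  have h0 : (0 : ℝ) ≤ Fintype.card X := by positivity
  nlinarith

section Refinement

variable {n : ℕ} {X Y U : Type*} [Fintype X] [Fintype Y]

/-- The product of the conditional marginals of a weight on `U × X × Y`. -/
noncomputable def markovProd (T : U × X × Y → ℝ) (p : U × X × Y) : ℝ :=
  (∑ y, T (p.1, p.2.1, y)) * (∑ x, T (p.1, x, p.2.2)) / ∑ x, ∑ y, T (p.1, x, y)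

theorem sq_sum_abs_emp_sub_markovProd_le [Fintype U] (u : Fin n → U) (x : Fin n → X)
    (y : Fin n → Y) :
    (∑ p, |emp (fun t => (u t, x t, y t)) p - markovProd (emp fun t => (u t, x t, y t)) p|) ^ 2
      ≤ Fintype.card X * (energy x (fun t => (u t, y t)) - energy x u) := by
  have h := sq_sum_abs_sub_le (fun a b c => emp (fun t => (u t, x t, y t)) (a, b, c))
    (fun _ _ _ => emp_nonneg _ _)
    (by have := sum_emp_le_one (fun t => (u t, x t, y t)); simpa [Fintype.sum_prod_type] using this)
  have h1 : ∀ a b, ∑ c, emp (fun t => (u t, x t, y t)) (a, b, c) = emp (fun t => (u t, x t)) (a, b) := by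
    intro a b
    rw [← sum_emp_snd (fun t => (u t, x t)) y]
    exact sum_congr rfl fun c _ => (emp_comp (f := fun p : U × X × Y => ((p.1, p.2.1), p.2.2))
      (by rintro ⟨_, _, _⟩ ⟨_, _, _⟩ h; simp_all) (fun t => (u t, x t, y t)) (a, b, c)).symm
  have h2 : ∀ a c, ∑ b, emp (fun t => (u t, x t, y t)) (a, b, c) = emp (fun t => (u t, y t)) (a, c) := by
    intro a c
    rw [← sum_emp_snd (fun t => (u t, y t)) x]
    exact sum_congr rfl fun b _ => (emp_comp (f := fun p : U × X × Y => ((p.1, p.2.2), p.2.1))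
      (by rintro ⟨_, _, _⟩ ⟨_, _, _⟩ h; simp_all) (fun t => (u t, x t, y t)) (a, b, c)).symm
  have h3 : ∀ a, ∑ b, emp (fun t => (u t, x t)) (a, b) = emp u a := fun a => sum_emp_snd u x a
  simp only [h1, h2, h3] at h
  simp only [markovProd, h1, h2, h3, Fintype.sum_prod_type]
  refine h.trans (le_of_eq ?_)
  rw [energy_eq_sum, energy_eq_sum, Fintype.sum_prod_type]
  congr 2
  refine sum_congr rfl fun a _ => ?_
  rw [sum_comm]
  refine sum_congr rfl fun c _ => sum_congr rfl fun b _ => ?_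
  rw [← emp_comp (f := fun p : U × X × Y => ((p.1, p.2.2), p.2.1))
      (by rintro ⟨_, _, _⟩ ⟨_, _, _⟩ h; simp_all) (fun t => (u t, x t, y t)) (a, b, c)]

variable {ι κ : Type*} [Fintype ι] [Fintype κ] [Nonempty ι] [Nonempty κ]

/-- A time-sharing sequence with boundedly many letters, a further refinement of which by the
average `y`-codeword hardly increases the energy. -/
theorem exists_refinement {X : Type*} [Nonempty Y] (x : ι → Fin n → X) (y : κ → Fin n → Y) {K : ℕ}
    (hK : 0 < K) :
    ∃ m ≤ Fintype.card Y ^ K, ∃ u : Fin n → Fin m,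
      ∑ i, ∑ j, (energy (x i) (fun t => (u t, y j t)) - energy (x i) u)
        ≤ (Fintype.card ι * Fintype.card κ : ℝ) / K := by
  by_contra! hcon
  have hι : (0 : ℝ) < Fintype.card ι := by exact_mod_cast Fintype.card_pos
  have hκ : (0 : ℝ) < Fintype.card κ := by exact_mod_cast Fintype.card_pos
  have hK' : (0 : ℝ) < K := by exact_mod_cast hK
  -- If no sequence works, then at each stage some `y`-codeword beats the average increment, and
  -- appending it raises the total energy by more than `card ι / K`. After `K + 1` stages the total
  -- exceeds `card ι`, although each energy is at most 1.
  have step : ∀ k ≤ K + 1, ∃ m ≤ Fintype.card Y ^ k, ∃ u : Fin n → Fin m,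
      (k : ℝ) / K * Fintype.card ι ≤ ∑ i, energy (x i) u := by
    intro k
    induction k with
    | zero =>
      intro _
      refine ⟨1, by simp, fun _ => 0, ?_⟩
      simp only [Nat.cast_zero, zero_div, zero_mul]
      exact sum_nonneg fun i _ => energy_nonneg _ _
    | succ k ih =>
      intro hk
      obtain ⟨m, hm, u, hu⟩ := ih (by omega)
      have h := hcon m (hm.trans (Nat.pow_le_pow_right Fintype.card_pos (by omega))) u
      rw [sum_comm] at h
      have hj : ∃ j ∈ (univ : Finset κ), (Fintype.card ι : ℝ) / K
          < ∑ i, (energy (x i) (fun t => (u t, y j t)) - energy (x i) u) := by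
        apply exists_lt_of_sum_lt
        rw [sum_const, card_univ, nsmul_eq_mul]
        refine lt_of_eq_of_lt ?_ h
        ring
      obtain ⟨j, -, hj⟩ := hj
      refine ⟨m * Fintype.card Y, by rw [pow_succ]; gcongr,
        fun t => finProdFinEquiv (u t, Fintype.equivFin Y (y j t)), ?_⟩
      have he : ∀ i, energy (x i) (fun t => finProdFinEquiv (u t, Fintype.equivFin Y (y j t)))
          = energy (x i) (fun t => (u t, y j t)) := fun i =>
        energy_comp (f := fun p : Fin m × Y => finProdFinEquiv (p.1, Fintype.equivFin Y p.2))
          (fun p q h => by simpa [Prod.ext_iff] using h) (x i) (fun t => (u t, y j t))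
      simp_rw [he]
      rw [sum_sub_distrib] at hj
      push_cast
      have : ((k : ℝ) + 1) / K * Fintype.card ι
        = (k : ℝ) / K * Fintype.card ι + Fintype.card ι / K := by ring
      linarith
  obtain ⟨m, -, u, hu⟩ := step (K + 1) le_rfl
  have h1 : ∑ i, energy (x i) u ≤ Fintype.card ι :=
    (sum_le_sum fun i _ => energy_le_one (x i) u).trans (by simp)
  have h2 : (1 : ℝ) < ((K + 1 : ℕ) : ℝ) / K := by
    rw [lt_div_iff₀ hK']; push_cast; linarith
  nlinarith

/-- Many pairs of codewords have a common joint type, close to a Markov chain, with a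
time-sharing sequence over an alphabet of bounded size. -/
theorem exists_common_type [Nonempty X] [Nonempty Y] {η : ℝ} (hη : 0 < η) :
    ∃ J : ℕ, ∀ (n : ℕ) (ι κ : Type) [Fintype ι] [Fintype κ] [Nonempty ι] [Nonempty κ]
      (x : ι → Fin n → X) (y : κ → Fin n → Y),
      ∃ (m : ℕ) (u : Fin n → Fin m) (T : Fin m × X × Y → ℝ) (G : Finset (ι × κ)),
        G.Nonempty ∧ (∀ p ∈ G, emp (fun t => (u t, x p.1 t, y p.2 t)) = T) ∧
        ∑ p, |T p - markovProd T p| ≤ η ∧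
        (Fintype.card ι * Fintype.card κ : ℝ) ≤ 2 * (n + 1 : ℝ) ^ J * #G := by
  classical
  -- With this `K` the mean square distance to the Markov product is below `η ^ 2 / 2`, so by
  -- Chebyshev at least half of the pairs are within `η`.
  obtain ⟨K, hK⟩ := exists_nat_gt (2 * Fintype.card X / η ^ 2)
  have hX : (0 : ℝ) < Fintype.card X := by exact_mod_cast Fintype.card_pos
  have hK0 : (0 : ℝ) < K := lt_trans (by positivity) hK
  refine ⟨Fintype.card Y ^ K * (Fintype.card X * Fintype.card Y), ?_⟩
  intro n ι κ _ _ _ _ x y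
  obtain ⟨m, hm, u, hu⟩ := exists_refinement x y (K := K) (by exact_mod_cast hK0)
  have hι : (0 : ℝ) < Fintype.card ι := by exact_mod_cast Fintype.card_pos
  have hκ : (0 : ℝ) < Fintype.card κ := by exact_mod_cast Fintype.card_pos
  set τ : ι × κ → Fin m × X × Y → ℝ := fun p => emp fun t => (u t, x p.1 t, y p.2 t) with hτ
  set g : ι × κ → ℝ := fun p => ∑ q, |τ p q - markovProd (τ p) q| with hg
  have hgsum : ∑ p, g p ^ 2 ≤ Fintype.card X * ((Fintype.card ι * Fintype.card κ : ℝ) / K) := by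
    refine (sum_le_sum fun p _ => sq_sum_abs_emp_sub_markovProd_le u (x p.1) (y p.2)).trans ?_
    rw [← mul_sum, Fintype.sum_prod_type]
    exact mul_le_mul_of_nonneg_left hu hX.le
  set H : Finset (ι × κ) := univ.filter fun p => g p ≤ η with hH
  have hHcard : (Fintype.card ι * Fintype.card κ : ℝ) ≤ 2 * #H := by
    have h1 : (#(univ.filter fun p => ¬ g p ≤ η) : ℝ) * η ^ 2 ≤ ∑ p, g p ^ 2 := by
      rw [← nsmul_eq_mul]
      refine (card_nsmul_le_sum _ (fun p => g p ^ 2) _ fun p hp => ?_).trans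
        (sum_le_sum_of_subset_of_nonneg (filter_subset _ _) fun p _ _ => sq_nonneg _)
      have := (mem_filter.1 hp).2
      push Not at this
      exact pow_le_pow_left₀ hη.le this.le 2
    have h2 : (#H : ℝ) + #(univ.filter fun p => ¬ g p ≤ η) = Fintype.card ι * Fintype.card κ := by
      have := card_filter_add_card_filter_not (s := (univ : Finset (ι × κ))) (fun p => g p ≤ η)
      rw [card_univ, Fintype.card_prod] at this
      exact_mod_cast this
    have h3 : Fintype.card X * ((Fintype.card ι * Fintype.card κ : ℝ) / K)
        ≤ η ^ 2 * ((Fintype.card ι * Fintype.card κ : ℝ) / 2) := by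
      rw [div_lt_iff₀ (by positivity)] at hK
      rw [← mul_div_assoc, ← mul_div_assoc, div_le_div_iff₀ hK0 two_pos]
      nlinarith [mul_pos hι hκ]
    have h4 : (#(univ.filter fun p => ¬ g p ≤ η) : ℝ)
        ≤ (Fintype.card ι * Fintype.card κ : ℝ) / 2 := by
      have := h1.trans (hgsum.trans h3)
      rw [mul_comm] at this
      exact le_of_mul_le_mul_left this (by positivity)
    linarith
  -- A type is recorded by its counts, so at most `(n + 1) ^ (m * |X| * |Y|)` types occur; the most
  -- frequent one among the good pairs is kept.
  set c : ι × κ → Fin m × X × Y → Fin (n + 1) := fun p q =>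
    ⟨#{t | (u t, x p.1 t, y p.2 t) = q}, Nat.lt_succ_of_le ((card_le_univ _).trans (by simp))⟩
  have hHne : H.Nonempty := by
    rw [← card_pos]
    have := mul_pos hι hκ
    have : (0 : ℝ) < #H := by linarith
    exact_mod_cast this
  obtain ⟨p₀, hp₀H, hp₀⟩ := exists_max_image H (fun p => #(H.filter fun p' => c p' = c p)) hHne
  refine ⟨m, u, τ p₀, H.filter fun p' => c p' = c p₀, ⟨p₀, by simp [hp₀H]⟩, ?_, ?_, ?_⟩
  · intro p hp
    ext q
    have := congrArg (fun f => ((f q : Fin (n + 1)) : ℕ)) (mem_filter.1 hp).2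
    simp only [c] at this
    simp only [τ, emp]
    convert congrArg (fun k : ℕ => (k : ℝ) / n) this using 1
    congr!
  · exact (mem_filter.1 hp₀H).2
  · have h1 : #H ≤ (n + 1) ^ (m * (Fintype.card X * Fintype.card Y)) *
        #(H.filter fun p' => c p' = c p₀) := by
      rw [card_eq_sum_card_image c H]
      refine (sum_le_card_nsmul _ _ (#(H.filter fun p' => c p' = c p₀)) ?_).trans ?_
      · intro b hb
        obtain ⟨p, hp, rfl⟩ := mem_image.1 hb
        exact hp₀ p hp
      · rw [smul_eq_mul]
        refine Nat.mul_le_mul_right _ ((card_le_univ _).trans ?_)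
        simp
    have h2 : (n + 1) ^ (m * (Fintype.card X * Fintype.card Y))
        ≤ (n + 1) ^ (Fintype.card Y ^ K * (Fintype.card X * Fintype.card Y)) :=
      Nat.pow_le_pow_right n.succ_pos (Nat.mul_le_mul_right _ hm)
    have h3 := h1.trans (Nat.mul_le_mul_right _ h2)
    have h4 : (#H : ℝ) ≤ (n + 1 : ℝ) ^ (Fintype.card Y ^ K * (Fintype.card X * Fintype.card Y)) *
        #(H.filter fun p' => c p' = c p₀) := by exact_mod_cast h3
    linarith

end Refinement

/-! ### The Markov chain with the same `(U, X)` and `(U, Y)` marginals. -/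

section Markov

variable {U X Y : Type*} [Fintype X] [Fintype Y] {T : U × X × Y → ℝ}

theorem markovProd_nonneg (hT : ∀ p, 0 ≤ T p) (p : U × X × Y) : 0 ≤ markovProd T p :=
  div_nonneg (mul_nonneg (sum_nonneg fun _ _ => hT _) (sum_nonneg fun _ _ => hT _))
    (sum_nonneg fun _ _ => sum_nonneg fun _ _ => hT _)

/-- Division by zero is harmless: when `u` has mass 0, nonnegativity makes both sides vanish. -/
theorem sum_snd_markovProd (hT : ∀ p, 0 ≤ T p) (u : U) (x : X) :
    ∑ y, markovProd T (u, x, y) = ∑ y, T (u, x, y) := by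
  simp only [markovProd]
  rw [← sum_div, ← mul_sum, sum_comm (f := fun y x => T (u, x, y))]
  rcases eq_or_ne (∑ x, ∑ y, T (u, x, y)) 0 with h | h
  · rw [h, div_zero]
    exact ((sum_eq_zero_iff_of_nonneg fun x _ => sum_nonneg fun y _ => hT _).1 h x
      (mem_univ x)).symm
  · rw [mul_div_cancel_right₀ _ h]

theorem sum_fst_markovProd (hT : ∀ p, 0 ≤ T p) (u : U) (y : Y) :
    ∑ x, markovProd T (u, x, y) = ∑ x, T (u, x, y) := by
  simp only [markovProd]
  rw [← sum_div, ← sum_mul]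
  rcases eq_or_ne (∑ x, ∑ y, T (u, x, y)) 0 with h | h
  · rw [h, div_zero]
    rw [sum_comm] at h
    exact ((sum_eq_zero_iff_of_nonneg fun y _ => sum_nonneg fun x _ => hT _).1 h y
      (mem_univ y)).symm
  · rw [mul_div_cancel_left₀ _ h]

theorem markovProd_mem_stdSimplex [Fintype U] (hT : T ∈ stdSimplex ℝ (U × X × Y)) :
    markovProd T ∈ stdSimplex ℝ (U × X × Y) := by
  refine ⟨markovProd_nonneg hT.1, ?_⟩
  rw [← hT.2]
  simp only [Fintype.sum_prod_type, sum_snd_markovProd hT.1]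

theorem isMarkov_markovProd (hT : ∀ p, 0 ≤ T p) : IsMarkov (markovProd T) := by
  intro u x y
  simp only [sum_snd_markovProd hT, sum_fst_markovProd hT]
  simp only [markovProd]
  rcases eq_or_ne (∑ x, ∑ y, T (u, x, y)) 0 with h | h
  · rw [h, mul_zero,
      (sum_eq_zero_iff_of_nonneg fun x _ => sum_nonneg fun y _ => hT _).1 h x (mem_univ x),
      zero_mul]
  · rw [div_mul_cancel₀ _ h]

end Markov

/-! ### Single-letter estimates: output kernels and perturbation of the test channel. -/

section SingleLetter

variable {Z : Type*} [Fintype Z]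

theorem kl_self (v : Z → ℝ) : kl v v = 0 := by
  refine sum_eq_zero fun z _ => ?_
  rcases eq_or_ne (v z) 0 with h | h <;> simp [h]

theorem div_le_exp_log {v q : Z → ℝ} (hv : v ∈ stdSimplex ℝ Z) {c : ℝ} (hc : 0 < c)
    (hq : ∀ z, c ≤ q z) (z : Z) : v z / q z ≤ Real.exp (Real.log (1 / c)) := by
  have hv1 : v z ≤ 1 := by
    rw [← hv.2]; exact single_le_sum (fun a _ => hv.1 a) (mem_univ z)
  rw [Real.exp_log (by positivity)]
  exact div_le_div₀ zero_le_one hv1 hc (hq z)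

theorem kl_le_log {v q : Z → ℝ} (hv : v ∈ stdSimplex ℝ Z) {c : ℝ} (hc : 0 < c)
    (hq : ∀ z, c ≤ q z) : kl v q ≤ Real.log (1 / c) := by
  have h : ∀ z, v z * Real.log (v z / q z) ≤ v z * Real.log (1 / c) := by
    intro z
    rcases (hv.1 z).eq_or_lt with h0 | h0
    · simp [← h0]
    · refine mul_le_mul_of_nonneg_left ?_ h0.le
      rw [Real.log_le_iff_le_exp (div_pos h0 (hc.trans_le (hq z)))]
      exact div_le_exp_log hv hc hq z
  refine (sum_le_sum fun z _ => h z).trans ?_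
  rw [← sum_mul, hv.2, one_mul]

/-- A lower bounded output kernel whose average relative entropy to the channel is close to the
conditional mutual information. -/
theorem exists_kernel_sum_kl_le {A C : Type*} [Fintype A] [Fintype C] [Nonempty Z] (p : A → C → ℝ)
    (hp : ∀ a c, 0 ≤ p a c) (hp1 : ∑ a, ∑ c, p a c ≤ 1) (V : A → C → Z → ℝ)
    (hV : ∀ a c, V a c ∈ stdSimplex ℝ Z) {τ : ℝ} (hτ : 0 < τ) (hτ1 : τ < 1) :
    ∃ Q : C → Z → ℝ, (∀ c z, τ / Fintype.card Z ≤ Q c z) ∧ (∀ c, ∑ z, Q c z ≤ 1) ∧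
      ∑ a, ∑ c, p a c * kl (V a c) (Q c)
        ≤ condMutualInfo (fun a z c => p a c * V a c z) + Real.log (1 / (1 - τ)) := by
  have hZ : (0 : ℝ) < Fintype.card Z := by exact_mod_cast Fintype.card_pos
  have h1τ : 0 < 1 - τ := by linarith
  set r : C → ℝ := fun c => ∑ a, p a c with hr
  set o : C → Z → ℝ := fun c z => ∑ a, p a c * V a c z with ho
  have hr0 : ∀ c, 0 ≤ r c := fun c => sum_nonneg fun a _ => hp a c
  have ho0 : ∀ c z, 0 ≤ o c z := fun c z => sum_nonneg fun a _ => mul_nonneg (hp a c) ((hV a c).1 z)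
  have hor : ∀ c, ∑ z, o c z = r c := by
    intro c
    simp only [o, r]
    rw [sum_comm]
    exact sum_congr rfl fun a _ => by rw [← mul_sum, (hV a c).2, mul_one]
  -- The true conditional output distribution mixed with the uniform one: the mixture bounds all
  -- likelihood ratios and costs only `log (1 / (1 - τ))`. Where `r c = 0` the quotient is 0, so
  -- rows may sum to less than 1.
  refine ⟨fun c z => (1 - τ) * (o c z / r c) + τ / Fintype.card Z, ?_, ?_, ?_⟩
  · intro c z
    have := mul_nonneg h1τ.le (div_nonneg (ho0 c z) (hr0 c))
    linarith
  · intro c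
    rw [sum_add_distrib, ← mul_sum, ← sum_div, hor]
    simp only [sum_const, card_univ, nsmul_eq_mul]
    rw [mul_div_cancel₀ _ hZ.ne']
    have := div_self_le_one (r c)
    nlinarith
  · have hrow : ∀ a c, ∑ z, p a c * V a c z = p a c := fun a c => by
      rw [← mul_sum, (hV a c).2, mul_one]
    have hterm : ∀ a c z, p a c * (V a c z *
          Real.log (V a c z / ((1 - τ) * (o c z / r c) + τ / Fintype.card Z)))
        ≤ p a c * V a c z * Real.log ((p a c * V a c z * r c) / (p a c * o c z))
          + Real.log (1 / (1 - τ)) * (p a c * V a c z) := by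
      intro a c z
      rcases (mul_nonneg (hp a c) ((hV a c).1 z)).eq_or_lt with h0 | h0
      · rw [← mul_assoc, ← h0]; simp
      have hpa : 0 < p a c := lt_of_le_of_ne (hp a c) fun h => by rw [← h] at h0; simp at h0
      have hva : 0 < V a c z := lt_of_le_of_ne ((hV a c).1 z) fun h => by rw [← h] at h0; simp at h0
      have hrc : 0 < r c := hpa.trans_le (single_le_sum (fun a _ => hp a c) (mem_univ a))
      have hoc : 0 < o c z := h0.trans_le (single_le_sum (f := fun a => p a c * V a c z)
        (fun a _ => mul_nonneg (hp a c) ((hV a c).1 z)) (mem_univ a))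
      rw [← mul_assoc, mul_comm (Real.log (1 / (1 - τ))), ← mul_add]
      refine mul_le_mul_of_nonneg_left ?_ h0.le
      rw [← Real.log_mul (by positivity) (by positivity)]
      refine Real.log_le_log (by positivity) ?_
      have : p a c * V a c z * r c / (p a c * o c z) * (1 / (1 - τ))
          = V a c z / ((1 - τ) * (o c z / r c)) := by field_simp
      rw [this]
      refine div_le_div_of_nonneg_left hva.le (by positivity) ?_
      have : 0 < τ / Fintype.card Z := by positivity
      linarith
    have hI : condMutualInfo (fun a z c => p a c * V a c z) = ∑ a, ∑ c, ∑ z,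
        p a c * V a c z * Real.log ((p a c * V a c z * r c) / (p a c * o c z)) := by
      unfold condMutualInfo
      refine sum_congr rfl fun a _ => ?_
      rw [sum_comm]
      refine sum_congr rfl fun c _ => sum_congr rfl fun z _ => ?_
      simp only [hrow]
      rfl
    rw [hI]
    have hlog : 0 ≤ Real.log (1 / (1 - τ)) := by
      apply Real.log_nonneg
      rw [le_div_iff₀ h1τ]
      linarith
    calc ∑ a, ∑ c, p a c * kl (V a c) (fun z => (1 - τ) * (o c z / r c) + τ / Fintype.card Z)
        ≤ ∑ a, ∑ c, ∑ z, (p a c * V a c z * Real.log ((p a c * V a c z * r c) / (p a c * o c z))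
          + Real.log (1 / (1 - τ)) * (p a c * V a c z)) := by
          refine sum_le_sum fun a _ => sum_le_sum fun c _ => ?_
          rw [kl, mul_sum]
          exact sum_le_sum fun z _ => hterm a c z
      _ = (∑ a, ∑ c, ∑ z, p a c * V a c z * Real.log ((p a c * V a c z * r c) / (p a c * o c z)))
          + Real.log (1 / (1 - τ)) * ∑ a, ∑ c, p a c := by
          simp only [sum_add_distrib, ← mul_sum, hrow]
      _ ≤ _ := by
          have := mul_le_mul_of_nonneg_left hp1 hlog
          linarith

variable {U X Y : Type*} [Fintype U] [Fintype X] [Fintype Y]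

/-- The variables conditioned upon in the rate inequality that holds are the only ones on which `Q`
depends. Once the codeword among them (if any) is fixed, all remaining pairs can be tested against
one common product distribution. -/
theorem exists_kernel_of_meetsRateCondition [Nonempty Z] {RX RY : ℝ} {P : U × X × Y → ℝ}
    (hP : P ∈ stdSimplex ℝ (U × X × Y)) {V : X → Y → Z → ℝ} (hV : IsChannel V)
    (h : MeetsRateCondition RX RY P V) {τ : ℝ} (hτ : 0 < τ) (hτ1 : τ < 1) :
    ∃ Q : U × X × Y → Z → ℝ, (∀ p z, τ / Fintype.card Z ≤ Q p z) ∧ (∀ p, ∑ z, Q p z ≤ 1) ∧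
      ((∑ p, P p * kl (V p.2.1 p.2.2) (Q p) ≤ RX + Real.log (1 / (1 - τ)) ∧
          ∀ u x x' y, Q (u, x, y) = Q (u, x', y)) ∨
        (∑ p, P p * kl (V p.2.1 p.2.2) (Q p) ≤ RY + Real.log (1 / (1 - τ)) ∧
          ∀ u x y y', Q (u, x, y) = Q (u, x, y')) ∨
        (∑ p, P p * kl (V p.2.1 p.2.2) (Q p) ≤ RX + RY + Real.log (1 / (1 - τ)) ∧
          ∀ u x x' y y', Q (u, x, y) = Q (u, x', y'))) := by
  have hP1 := hP.2
  rw [Fintype.sum_prod_type] at hP1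
  simp only [Fintype.sum_prod_type] at hP1 ⊢
  rcases h with h | h | h
  · obtain ⟨Q, hQ, hQ1, hle⟩ := exists_kernel_sum_kl_le
      (fun (x : X) (c : Y × U) => P (c.2, x, c.1)) (fun _ _ => hP.1 _)
      (by
        rw [← hP1, sum_comm (γ := U)]
        refine le_of_eq (sum_congr rfl fun x _ => ?_)
        rw [Fintype.sum_prod_type, sum_comm])
      (fun x c => V x c.1) (fun _ _ => hV _ _) hτ hτ1
    refine ⟨fun p => Q (p.2.2, p.1), fun _ _ => hQ _ _, fun _ => hQ1 _,
      Or.inl ⟨?_, fun _ _ _ _ => rfl⟩⟩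
    refine le_trans (le_of_eq ?_) (hle.trans (add_le_add_left h _))
    rw [sum_comm]
    refine sum_congr rfl fun x _ => ?_
    rw [Fintype.sum_prod_type, sum_comm]
  · obtain ⟨Q, hQ, hQ1, hle⟩ := exists_kernel_sum_kl_le
      (fun (y : Y) (c : X × U) => P (c.2, c.1, y)) (fun _ _ => hP.1 _)
      (by
        rw [← hP1, sum_comm, Fintype.sum_prod_type, sum_comm])
      (fun y c => V c.1 y) (fun _ _ => hV _ _) hτ hτ1
    refine ⟨fun p => Q (p.2.1, p.1), fun _ _ => hQ _ _, fun _ => hQ1 _,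
      Or.inr (Or.inl ⟨?_, fun _ _ _ _ => rfl⟩)⟩
    refine le_trans (le_of_eq ?_) (hle.trans (add_le_add_left h _))
    rw [sum_comm (γ := Y), Fintype.sum_prod_type, sum_comm]
  · obtain ⟨Q, hQ, hQ1, hle⟩ := exists_kernel_sum_kl_le
      (fun (a : X × Y) (u : U) => P (u, a.1, a.2)) (fun _ _ => hP.1 _)
      (by
        rw [← hP1, sum_comm]
        exact le_of_eq (sum_congr rfl fun u _ => Fintype.sum_prod_type _))
      (fun a _ => V a.1 a.2) (fun _ _ => hV _ _) hτ hτ1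
    refine ⟨fun p => Q p.1, fun _ _ => hQ _ _, fun _ => hQ1 _,
      Or.inr (Or.inr ⟨?_, fun _ _ _ _ _ => rfl⟩)⟩
    refine le_trans (le_of_eq ?_) (hle.trans (add_le_add_left h _))
    rw [sum_comm (t := (univ : Finset U))]
    exact sum_congr rfl fun u _ => (Fintype.sum_prod_type
      (fun a : X × Y => P (u, a.1, a.2) * kl (V a.1 a.2) (Q u))).symm

/-- Finiteness of the conditional divergence, in terms of real numbers. -/
theorem of_condDivergence_le {V W : X → Y → Z → ℝ} (hV : IsChannel V) (hW : IsChannel W)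
    {P : X → Y → ℝ} (hP : ∀ x y, 0 ≤ P x y) {e : ℝ} (he : 0 ≤ e)
    (h : condDivergence V W P ≤ ENNReal.ofReal e) :
    (∀ x y, 0 < P x y → ∀ z, W x y z = 0 → V x y z = 0) ∧
      ∑ x, ∑ y, P x y * kl (V x y) (W x y) ≤ e := by
  have hac : ∀ x y, 0 < P x y → ∀ z, W x y z = 0 → V x y z = 0 := by
    intro x y hxy
    by_contra hcon
    have h1 : ENNReal.ofReal (P x y) * relEntropy (V x y) (W x y) ≤ condDivergence V W P :=
      (single_le_sum (f := fun y => ENNReal.ofReal (P x y) * relEntropy (V x y) (W x y))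
        (fun _ _ => zero_le) (mem_univ y)).trans
      (single_le_sum (f := fun x => ∑ y, ENNReal.ofReal (P x y) * relEntropy (V x y) (W x y))
        (fun _ _ => zero_le) (mem_univ x))
    rw [relEntropy, if_neg hcon, ENNReal.mul_top (by simpa using hxy)] at h1
    exact absurd (top_le_iff.1 (h1.trans h)) ENNReal.ofReal_ne_top
  refine ⟨hac, ?_⟩
  have hnn : ∀ x y, 0 ≤ P x y * kl (V x y) (W x y) := by
    intro x y
    rcases (hP x y).eq_or_lt with h0 | h0
    · simp [← h0]
    · exact mul_nonneg h0.le (kl_nonneg (hV x y).1 (hW x y).1 (hV x y).2 (hW x y).2.le (hac x y h0))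
  rw [← ENNReal.ofReal_le_ofReal_iff he]
  refine le_trans (le_of_eq ?_) h
  rw [ENNReal.ofReal_sum_of_nonneg fun x _ => sum_nonneg fun y _ => hnn x y]
  refine sum_congr rfl fun x _ => ?_
  rw [ENNReal.ofReal_sum_of_nonneg fun y _ => hnn x y]
  refine sum_congr rfl fun y _ => ?_
  rcases (hP x y).eq_or_lt with h0 | h0
  · simp [← h0]
  · rw [relEntropy, if_pos (hac x y h0), ENNReal.ofReal_mul h0.le, kl]

open Classical in
/-- The channel that agrees with `V` on the pairs with probability at least `β` under `P`, and with
`W` on the other ones. -/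
noncomputable def truncChannel (V W : X → Y → Z → ℝ) (P : U × X × Y → ℝ) (β : ℝ) : X → Y → Z → ℝ :=
  fun x y => if β ≤ ∑ u, P (u, x, y) then V x y else W x y

theorem sum_mul_sub_le {A : Type*} [Fintype A] {T P f : A → ℝ} {η L : ℝ}
    (hTP : ∑ a, |T a - P a| ≤ η) (hf : ∀ a, 0 ≤ f a) (hfL : ∀ a, f a ≤ L) (hL : 0 ≤ L) :
    ∑ a, T a * f a ≤ ∑ a, P a * f a + η * L := by
  have h : ∀ a, T a * f a ≤ P a * f a + |T a - P a| * L := by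
    intro a
    have h1 : (T a - P a) * f a ≤ |T a - P a| * f a :=
      mul_le_mul_of_nonneg_right (le_abs_self _) (hf a)
    have h2 := mul_le_mul_of_nonneg_left (hfL a) (abs_nonneg (T a - P a))
    nlinarith
  refine (sum_le_sum fun a _ => h a).trans ?_
  rw [sum_add_distrib, ← sum_mul]
  have := mul_le_mul_of_nonneg_right hTP hL
  linarith

/-- Divergences from `Q` are bounded by `log (1 / c)`, so errors are additive: `η` for passing from
`T` to `P`, and `β` for each of the at most `|X| |Y|` rare input pairs. -/
theorem sum_mul_kl_truncChannel_le {V W : X → Y → Z → ℝ} (hV : IsChannel V) (hW : IsChannel W)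
    {T P : U × X × Y → ℝ} (hP : ∀ p, 0 ≤ P p) {η β c : ℝ} (hβ : 0 ≤ β)
    (hTP : ∑ p, |T p - P p| ≤ η) (hc : 0 < c) (hc1 : c ≤ 1) {Q : U × X × Y → Z → ℝ}
    (hQ : ∀ p z, c ≤ Q p z) (hQ1 : ∀ p, ∑ z, Q p z ≤ 1) :
    ∑ p, T p * kl (truncChannel V W P β p.2.1 p.2.2) (Q p) ≤ ∑ p, P p * kl (V p.2.1 p.2.2) (Q p)
      + (η + Fintype.card X * Fintype.card Y * β) * Real.log (1 / c) := by
  classical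
  have hL : 0 ≤ Real.log (1 / c) := Real.log_nonneg (by rw [le_div_iff₀ hc]; linarith)
  have hV' : IsChannel (truncChannel V W P β) := fun x y => by
    unfold truncChannel; split_ifs; exacts [hV x y, hW x y]
  have hkl : ∀ v ∈ stdSimplex ℝ Z, ∀ p, 0 ≤ kl v (Q p) := fun v hv p =>
    kl_nonneg hv.1 (fun z => hc.le.trans (hQ p z)) hv.2 (hQ1 p)
      (fun z hz => absurd hz (hc.trans_le (hQ p z)).ne')
  have h1 := sum_mul_sub_le (f := fun p : U × X × Y => kl (truncChannel V W P β p.2.1 p.2.2) (Q p))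
    hTP (fun p => hkl _ (hV' _ _) p) (fun p => kl_le_log (hV' _ _) hc (hQ p)) hL
  have h2 : ∀ p : U × X × Y, P p * kl (truncChannel V W P β p.2.1 p.2.2) (Q p)
      ≤ P p * kl (V p.2.1 p.2.2) (Q p)
        + (if β ≤ ∑ u, P (u, p.2) then 0 else P p) * Real.log (1 / c) := by
    rintro ⟨u, x, y⟩
    unfold truncChannel
    dsimp only
    split_ifs with h
    · simp
    · have h3 := mul_le_mul_of_nonneg_left (kl_le_log (hW x y) hc (hQ (u, x, y))) (hP (u, x, y))
      have h4 := mul_nonneg (hP (u, x, y)) (hkl _ (hV x y) (u, x, y))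
      linarith
  have h3 : ∑ p : U × X × Y, (if β ≤ ∑ u, P (u, p.2) then 0 else P p)
      ≤ Fintype.card X * Fintype.card Y * β := by
    rw [Fintype.sum_prod_type, sum_comm]
    refine (sum_le_sum (g := fun _ => β) fun q _ => ?_).trans ?_
    · dsimp only
      split_ifs with h
      · simpa using hβ
      · exact (not_le.1 h).le
    · simp
  have h4 := sum_le_sum fun p (_ : p ∈ univ) => h2 p
  rw [sum_add_distrib, ← sum_mul] at h4
  have h5 := mul_le_mul_of_nonneg_right h3 hL
  rw [add_mul]
  linarith

/-- Divergences from `W` have no bound uniform in `W`, so the error must be multiplicative. On pairs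
of mass at least `β`, the mass under `T` is at most `1 + η / β` times that under `P`; on the rare
pairs, where `V` need not be absolutely continuous, the truncated channel is `W` itself and
contributes 0. -/
theorem sum_mul_kl_truncChannel_self_le {V W : X → Y → Z → ℝ} (hV : IsChannel V)
    (hW : IsChannel W) {T P : U × X × Y → ℝ} (hP : ∀ p, 0 ≤ P p) {η β : ℝ} (hβ : 0 < β)
    (hη : 0 ≤ η) (hTP : ∑ p, |T p - P p| ≤ η)
    (hac : ∀ x y, 0 < ∑ u, P (u, x, y) → ∀ z, W x y z = 0 → V x y z = 0) :
    ∑ p, T p * kl (truncChannel V W P β p.2.1 p.2.2) (W p.2.1 p.2.2)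
      ≤ (1 + η / β) * ∑ x, ∑ y, (∑ u, P (u, x, y)) * kl (V x y) (W x y) := by
  classical
  rw [Fintype.sum_prod_type, sum_comm, mul_sum, Fintype.sum_prod_type]
  refine sum_le_sum fun x _ => ?_
  rw [mul_sum]
  refine sum_le_sum fun y _ => ?_
  dsimp only
  rw [← sum_mul, ← mul_assoc]
  have hP0 : 0 ≤ ∑ u, P (u, x, y) := sum_nonneg fun u _ => hP _
  have hc : 0 ≤ 1 + η / β := by positivity
  unfold truncChannel
  split_ifs with h
  · refine mul_le_mul_of_nonneg_right ?_ (kl_nonneg (hV x y).1 (hW x y).1 (hV x y).2 (hW x y).2.le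
      (hac x y (hβ.trans_le h)))
    have h1 : ∑ u, T (u, x, y) - ∑ u, P (u, x, y) ≤ η := by
      rw [← sum_sub_distrib]
      refine le_trans ?_ hTP
      rw [Fintype.sum_prod_type]
      exact sum_le_sum fun u _ => (le_abs_self _).trans
        (single_le_sum (f := fun q : X × Y => |T (u, q) - P (u, q)|) (fun _ _ => abs_nonneg _)
          (mem_univ (x, y)))
    have h2 : η ≤ η / β * ∑ u, P (u, x, y) := by
      rw [div_mul_eq_mul_div, le_div_iff₀ hβ]
      exact mul_le_mul_of_nonneg_left h hη
    linarith
  · rw [kl_self, mul_zero]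
    rcases hP0.eq_or_lt with h0 | h0
    · simp [← h0]
    · exact mul_nonneg (mul_nonneg hc h0.le) (kl_nonneg (hV x y).1 (hW x y).1 (hV x y).2
        (hW x y).2.le (hac x y h0))

end SingleLetter

/-! ### The sphere-packing bound for the maximal error. -/

/-- The single-letter test channel and its output kernel for a type close to a Markov chain. -/
theorem exists_test_channel {X Y Z : Type*} [Fintype X] [Fintype Y] [Fintype Z] [Nonempty Z]
    {RX RY : ℝ} {W : X → Y → Z → ℝ} (hW : IsChannel W) {m : ℕ} {T : Fin m × X × Y → ℝ}
    (hT : T ∈ stdSimplex ℝ (Fin m × X × Y)) {η β τ e : ℝ} (hη : 0 ≤ η)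
    (hTP : ∑ p, |T p - markovProd T p| ≤ η) (hβ : 0 < β) (hτ : 0 < τ) (hτ1 : τ < 1) (he : 0 ≤ e)
    (hE : maxErrorSpherePackingExponent RX RY W < ENNReal.ofReal e) {ρ : ℝ}
    (hρ : Real.log (1 / (1 - τ)) + (η + Fintype.card X * Fintype.card Y * β) *
      Real.log (1 / (τ / Fintype.card Z)) ≤ ρ) :
    ∃ V : X → Y → Z → ℝ, IsChannel V ∧ (∀ x y z, W x y z = 0 → V x y z = 0) ∧
      ∑ p, T p * kl (V p.2.1 p.2.2) (W p.2.1 p.2.2) ≤ (1 + η / β) * e ∧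
      ∃ Q : Fin m × X × Y → Z → ℝ, (∀ p z, τ / Fintype.card Z ≤ Q p z) ∧ (∀ p, ∑ z, Q p z ≤ 1) ∧
      ((∑ p, T p * kl (V p.2.1 p.2.2) (Q p) ≤ RX + ρ ∧ ∀ u x x' y, Q (u, x, y) = Q (u, x', y)) ∨
        (∑ p, T p * kl (V p.2.1 p.2.2) (Q p) ≤ RY + ρ ∧ ∀ u x y y', Q (u, x, y) = Q (u, x, y')) ∨
        (∑ p, T p * kl (V p.2.1 p.2.2) (Q p) ≤ RX + RY + ρ ∧
          ∀ u x x' y y', Q (u, x, y) = Q (u, x', y'))) := by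
  set P := markovProd T
  have hP : P ∈ stdSimplex ℝ (Fin m × X × Y) := markovProd_mem_stdSimplex hT
  -- The exponent is used only at the Markov product of `T`. The strict inequality yields a channel
  -- `V` without any claim that the infimum is attained.
  have hlt : (⨅ (V : X → Y → Z → ℝ) (_ : IsChannel V) (_ : MeetsRateCondition RX RY P V),
      condDivergence V W (fun x y => ∑ u, P (u, x, y))) < ENNReal.ofReal e := by
    refine lt_of_le_of_lt ?_ hE
    unfold maxErrorSpherePackingExponent
    exact le_iSup_of_le m (le_iSup_of_le P (le_iSup_of_le hP
      (le_iSup_of_le (isMarkov_markovProd hT.1) le_rfl)))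
  simp only [iInf_lt_iff] at hlt
  obtain ⟨V, hV, hrate, hdiv⟩ := hlt
  obtain ⟨hac, hkl⟩ := of_condDivergence_le hV hW
    (fun x y => sum_nonneg fun u _ => hP.1 (u, x, y)) he hdiv.le
  have hZ : (1 : ℝ) ≤ Fintype.card Z := by exact_mod_cast Nat.succ_le_of_lt Fintype.card_pos
  have hc : 0 < τ / Fintype.card Z := by positivity
  have hc1 : τ / Fintype.card Z ≤ 1 := by
    rw [div_le_one (by linarith)]; linarith
  refine ⟨truncChannel V W P β, ?_, ?_, ?_, ?_⟩
  · intro x y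
    unfold truncChannel
    split_ifs
    exacts [hV x y, hW x y]
  · intro x y z hz
    unfold truncChannel
    split_ifs with h
    exacts [hac x y (hβ.trans_le h) z hz, hz]
  · exact (sum_mul_kl_truncChannel_self_le hV hW hP.1 hβ hη hTP hac).trans
      (mul_le_mul_of_nonneg_left hkl (by positivity))
  · obtain ⟨Q, hQ, hQ1, h⟩ := exists_kernel_of_meetsRateCondition hP hV hrate hτ hτ1
    have hle := sum_mul_kl_truncChannel_le hV hW hP.1 hβ.le hTP hc hc1 hQ hQ1
    refine ⟨Q, hQ, hQ1, ?_⟩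
    rcases h with ⟨h, h'⟩ | ⟨h, h'⟩ | ⟨h, h'⟩
    · exact Or.inl ⟨by linarith, h'⟩
    · exact Or.inr (Or.inl ⟨by linarith, h'⟩)
    · exact Or.inr (Or.inr ⟨by linarith, h'⟩)

theorem eventually_pow_mul_exp_lt (J : ℕ) {b c : ℝ} (hb : 0 < b) (hc : 0 < c) :
    ∀ᶠ n : ℕ in atTop, c * (n + 1 : ℝ) ^ J < Real.exp (n * b) := by
  have h := (tendsto_pow_const_mul_const_pow_of_abs_lt_one J (r := Real.exp (-b))
    (by rw [abs_of_pos (Real.exp_pos _)]; exact Real.exp_lt_one_iff.2 (by linarith))).comp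
    (tendsto_add_atTop_nat 1)
  filter_upwards [h.eventually_lt_const (show (0 : ℝ) < Real.exp (-b) / c by positivity)] with n hn
  simp only [Function.comp_apply, pow_succ (Real.exp (-b))] at hn
  rw [lt_div_iff₀ hc, ← Real.exp_nat_mul] at hn
  push_cast at hn
  have h1 : Real.exp (n * -b) * Real.exp (n * b) = 1 := by
    rw [← Real.exp_add]; simp
  have h2 : (c * (n + 1 : ℝ) ^ J) * Real.exp (n * -b) < 1 := by
    have := Real.exp_pos (-b)
    by_contra! hcon
    nlinarith
  have h3 := Real.exp_pos (n * -b)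
  by_contra! hcon
  nlinarith

theorem eventually_lt_mul {b : ℝ} (hb : 0 < b) (c : ℝ) : ∀ᶠ n : ℕ in atTop, c < n * b :=
  (tendsto_natCast_atTop_atTop.atTop_mul_const hb).eventually_gt_atTop c

theorem blockProb_nonneg {X Y Z : Type*} [Fintype Z] {n : ℕ} {W : X → Y → Z → ℝ} (hW : IsChannel W)
    (x : Fin n → X) (y : Fin n → Y) (z : Fin n → Z) : 0 ≤ blockProb W x y z :=
  prod_nonneg fun _ _ => (hW _ _).1 _

theorem blockProbSet_nonneg {X Y Z : Type*} [Fintype Z] {n : ℕ} {W : X → Y → Z → ℝ}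
    (hW : IsChannel W) (x : Fin n → X) (y : Fin n → Y) (B : Set (Fin n → Z)) :
    0 ≤ blockProbSet W x y B :=
  sum_nonneg fun _ _ => Set.indicator_nonneg (fun _ _ => blockProb_nonneg hW _ _ _) _

theorem blockProbSet_add_compl {X Y Z : Type*} [Fintype Z] {n : ℕ} {W : X → Y → Z → ℝ}
    (hW : IsChannel W) (x : Fin n → X) (y : Fin n → Y) (B : Set (Fin n → Z)) :
    blockProbSet W x y B + blockProbSet W x y Bᶜ = 1 := by
  unfold blockProbSet
  rw [← sum_add_distrib]
  simp only [Set.indicator_self_add_compl_apply]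
  exact sum_prod_apply_eq_one fun t => (hW (x t) (y t)).2

theorem exists_le_card_mul_card_filter {ι κ : Type*} [Fintype κ] [Nonempty κ] [DecidableEq κ]
    (G : Finset ι) (f : ι → κ) : ∃ j, #G ≤ Fintype.card κ * #(G.filter fun i => f i = j) := by
  obtain ⟨j, -, hj⟩ := exists_max_image (univ : Finset κ) (fun j => #(G.filter fun i => f i = j))
    univ_nonempty
  refine ⟨j, ?_⟩
  rw [card_eq_sum_card_fiberwise (t := univ) (f := f) (by simp)]
  exact (sum_le_card_nsmul _ _ _ fun j' hj' => hj j' hj').trans (by simp)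

/-- The sphere-packing bound for the maximal error probability. -/
theorem exists_exp_le_blockProbSet_compl {X Y Z : Type*} [Fintype X] [Fintype Y] [Fintype Z]
    [Nonempty X] [Nonempty Y] [Nonempty Z] (RX RY : ℝ) {δ : ℝ} (hδ : 0 < δ) :
    ∃ n₀ : ℕ, ∀ W : X → Y → Z → ℝ, IsChannel W → ∀ n : ℕ, n₀ ≤ n →
      ∀ (ι κ : Type) [Fintype ι] [Fintype κ] (x : ι → Fin n → X) (y : κ → Fin n → Y)
        (D : ι → κ → Set (Fin n → Z)),
        (∀ i j i' j', (i, j) ≠ (i', j') → Disjoint (D i j) (D i' j')) →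
        Real.exp (n * (RX + δ)) ≤ Fintype.card ι → Real.exp (n * (RY + δ)) ≤ Fintype.card κ →
        ∀ e : ℝ, 0 ≤ e → maxErrorSpherePackingExponent RX RY W ≤ ENNReal.ofReal e →
        ∃ i j, Real.exp (-(n * ((e + δ) * (1 + δ)))) ≤ blockProbSet W (x i) (y j) (D i j)ᶜ := by
  classical
  have hX : (0 : ℝ) < Fintype.card X := by exact_mod_cast Fintype.card_pos
  have hY : (0 : ℝ) < Fintype.card Y := by exact_mod_cast Fintype.card_pos
  have hZ : (1 : ℝ) ≤ Fintype.card Z := by exact_mod_cast Nat.succ_le_of_lt Fintype.card_pos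
  -- All parameters up to `n₀` depend on `δ` and the alphabets but not on `W`. This `ε`, the success
  -- probability to be reached under `V`, satisfies `(1 + δ) * (1 - ε) = (1 + δ / 2) + δ / 4`.
  obtain ⟨ε, hε, hεδ⟩ : ∃ ε : ℝ, 0 < ε ∧ (1 + δ) * ε = δ / 4 :=
    ⟨δ / (4 * (1 + δ)), by positivity, by field_simp⟩
  obtain ⟨τ, hτ, hτ1, hτlog⟩ : ∃ τ : ℝ, 0 < τ ∧ τ < 1 ∧ Real.log (1 / (1 - τ)) = δ / 8 := by
    refine ⟨1 - Real.exp (-(δ / 8)), sub_pos.2 (Real.exp_lt_one_iff.2 (by linarith)),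
      by linarith [Real.exp_pos (-(δ / 8))], ?_⟩
    rw [sub_sub_cancel, one_div, Real.log_inv, Real.log_exp, neg_neg]
  have hc : 0 < τ / Fintype.card Z := by positivity
  have hc1 : τ / Fintype.card Z ≤ 1 := by rw [div_le_one (by linarith)]; linarith
  set L := Real.log (1 / (τ / Fintype.card Z)) with hLdef
  have hL : 0 ≤ L := Real.log_nonneg (by rw [le_div_iff₀ hc]; linarith)
  obtain ⟨β, hβ, hβL⟩ : ∃ β : ℝ, 0 < β ∧ Fintype.card X * Fintype.card Y * β * (L + 1) = δ / 16 :=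
    ⟨δ / (16 * (L + 1) * (Fintype.card X * Fintype.card Y)), by positivity, by field_simp⟩
  obtain ⟨η, hη, hηL, hηβ⟩ : ∃ η : ℝ, 0 < η ∧ η * (L + 1) ≤ δ / 16 ∧ η / β ≤ δ / 2 := by
    refine ⟨min (δ / (16 * (L + 1))) (β * (δ / 2)), by positivity, ?_, ?_⟩
    · refine (mul_le_mul_of_nonneg_right (min_le_left _ _) (by linarith)).trans (le_of_eq ?_)
      field_simp
    · rw [div_le_iff₀ hβ]
      exact (min_le_right _ _).trans (mul_comm _ _).le
  -- The rate budget: `δ / 8` for mixing with the uniform distribution, and `δ / 16` each for the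
  -- distance to the Markov chain and for truncation.
  have hρ : Real.log (1 / (1 - τ)) + (η + Fintype.card X * Fintype.card Y * β) *
      Real.log (1 / (τ / Fintype.card Z)) ≤ δ / 4 := by
    rw [hτlog, ← hLdef]
    have : 0 < Fintype.card X * Fintype.card Y * β := by positivity
    nlinarith
  set C := Fintype.card Z * (4 + L ^ 2) with hC
  have hC0 : 0 < C := by positivity
  -- The Chernoff exponent `-s * n * (δ / 4) + n * s ^ 2 * C` is then at most `-n * s * (δ / 8)`.
  obtain ⟨s, hs, hsL, hsC⟩ : ∃ s : ℝ, 0 < s ∧ s * L ≤ 1 ∧ s * C ≤ δ / 8 := by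
    refine ⟨min (1 / (L + 1)) (δ / 8 / C), by positivity, ?_, ?_⟩
    · refine (mul_le_mul_of_nonneg_right (min_le_left _ _) hL).trans ?_
      rw [div_mul_eq_mul_div, div_le_one (by linarith)]
      linarith
    · refine (mul_le_mul_of_nonneg_right (min_le_right _ _) hC0.le).trans (le_of_eq ?_)
      field_simp
  obtain ⟨J, hJ⟩ := exists_common_type (X := X) (Y := Y) hη
  obtain ⟨n₀, hn₀⟩ := eventually_atTop.1 ((eventually_gt_atTop 0).and
    ((eventually_pow_mul_exp_lt J (half_pos hδ) (show 0 < 2 * (2 / ε) by positivity)).and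
    ((eventually_lt_mul (show 0 < s * (δ / 8) by positivity) (-Real.log (ε / 2))).and
    (eventually_lt_mul (show 0 < δ * (δ / 4) by positivity) (Real.log 2)))))
  refine ⟨n₀, fun W hW n hn ι κ _ _ x y D hD hι hκ e he hE => ?_⟩
  obtain ⟨hnpos, hnJ, hns, hn2⟩ := hn₀ n hn
  have hn0 : (0 : ℝ) < n := by exact_mod_cast hnpos
  have hι0 : (0 : ℝ) < Fintype.card ι := (Real.exp_pos _).trans_le hι
  have hκ0 : (0 : ℝ) < Fintype.card κ := (Real.exp_pos _).trans_le hκ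
  have : Nonempty ι := Fintype.card_pos_iff.1 (by exact_mod_cast hι0)
  have : Nonempty κ := Fintype.card_pos_iff.1 (by exact_mod_cast hκ0)
  by_contra! hcon
  obtain ⟨m, u, T, G, ⟨p₀, hp₀⟩, hGT, hTP, hGcard⟩ := hJ n ι κ x y
  have hT : T ∈ stdSimplex ℝ (Fin m × X × Y) := by
    rw [← hGT p₀ hp₀]
    exact ⟨fun _ => emp_nonneg _ _, sum_emp hnpos.ne' _⟩
  -- Replacing `e` by `e + δ` makes the bound on the exponent strict, and keeps it at least `δ` even
  -- when `e = 0`.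
  obtain ⟨V, hV, hac, hVW, Q, hQ, hQ1, hcases⟩ := exists_test_channel hW hT hη.le hTP hβ hτ hτ1
    (show 0 ≤ e + δ by linarith)
    (hE.trans_lt ((ENNReal.ofReal_lt_ofReal_iff (by linarith)).2 (by linarith))) hρ
  have hsum : ∀ p ∈ G, ∀ f : Fin m × X × Y → ℝ,
      ∑ t, f (u t, x p.1 t, y p.2 t) = n * ∑ q, T q * f q := by
    intro p hp f
    rw [← hGT p hp, sum_emp_mul]
    field_simp
  have hsucc : ∀ p ∈ G, ε ≤ blockProbSet V (x p.1) (y p.2) (D p.1 p.2) := by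
    intro p hp
    have h1 := mul_prob_le_sum_kl_add_log_two (V := fun t => V (x p.1 t) (y p.2 t))
      (W := fun t => W (x p.1 t) (y p.2 t)) (fun _ => hV _ _) (fun _ => hW _ _)
      (fun _ _ => hac _ _ _) (D p.1 p.2)ᶜ (a := n * ((e + δ) * (1 + δ))) (by
        have := mul_le_mul_of_nonneg_right (hcon p.1 p.2).le
          (Real.exp_pos (n * ((e + δ) * (1 + δ)))).le
        rwa [← Real.exp_add, neg_add_cancel, Real.exp_zero] at this)
    rw [hsum p hp fun q => kl (V q.2.1 q.2.2) (W q.2.1 q.2.2)] at h1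
    have h2 := blockProbSet_add_compl hV (x p.1) (y p.2) (D p.1 p.2)
    change n * ((e + δ) * (1 + δ)) * blockProbSet V (x p.1) (y p.2) (D p.1 p.2)ᶜ ≤ _ at h1
    rw [← eq_sub_iff_add_eq'] at h2
    rw [h2] at h1
    have h3 : ∑ q, T q * kl (V q.2.1 q.2.2) (W q.2.1 q.2.2) ≤ (1 + δ / 2) * (e + δ) :=
      hVW.trans (mul_le_mul_of_nonneg_right (by linarith) (by linarith))
    have h4 := mul_le_mul_of_nonneg_left h3 hn0.le
    set v := blockProbSet V (x p.1) (y p.2) (D p.1 p.2)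
    by_contra! hv
    have h5 : δ / 4 ≤ (1 + δ) * (1 - v) - (1 + δ / 2) := by
      have := mul_le_mul_of_nonneg_left hv.le (show 0 ≤ 1 + δ by linarith)
      linarith
    -- If the success probability were below `ε`, the divergence bound would fail by at least `n * δ
    -- * (δ / 4)`, which exceeds the `log 2` lost in the change of measure.
    have h6 : n * (δ * (δ / 4)) ≤ n * ((e + δ) * ((1 + δ) * (1 - v) - (1 + δ / 2))) := by
      refine mul_le_mul_of_nonneg_left ?_ hn0.le
      exact mul_le_mul (by linarith) h5 (by positivity) (by linarith)
    have h7 : n * ((e + δ) * ((1 + δ) * (1 - v) - (1 + δ / 2)))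
        = n * ((e + δ) * (1 + δ)) * (1 - v) - n * ((1 + δ / 2) * (e + δ)) := by ring
    linarith
  have strong : ∀ G' ⊆ G, ∀ q : Fin n → Z → ℝ,
      (∀ p ∈ G', ∀ t, Q (u t, x p.1 t, y p.2 t) = q t) → ∀ R : ℝ,
      ∑ p, T p * kl (V p.2.1 p.2.2) (Q p) ≤ R + δ / 4 →
      #G' ≤ 2 / ε * Real.exp (n * (R + δ / 2)) := by
    intro G' hG' q hq R hR
    rcases G'.eq_empty_or_nonempty with rfl | ⟨p₁, hp₁⟩
    · simp; positivity
    have hqc : ∀ t z, τ / Fintype.card Z ≤ q t z := fun t z => by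
      rw [← hq p₁ hp₁ t]; exact hQ _ z
    have h := card_mul_le_exp G' (fun p t => V (x p.1 t) (y p.2 t)) (Q := q)
      (fun _ _ _ => hV _ _) (fun t z => hc.trans_le (hqc t z))
      (fun t => by rw [← hq p₁ hp₁ t]; exact hQ1 _)
      (fun p hp t z => div_le_exp_log (hV _ _) hc (hqc t) z) hs.le hsL (fun p => D p.1 p.2)
      (fun p _ p' _ hne => hD _ _ _ _ hne) (κ := n * (R + δ / 4)) (γ := δ / 4) (ε := ε)
      (fun p hp => by
        rw [← sum_congr rfl fun t _ => congrArg (kl (V (x p.1 t) (y p.2 t))) (hq p hp t),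
          hsum p (hG' hp) fun a => kl (V a.2.1 a.2.2) (Q a)]
        exact mul_le_mul_of_nonneg_left hR hn0.le)
      (fun p hp => hsucc p (hG' hp))
      (by
        rw [← Real.le_log_iff_exp_le (by positivity)]
        change -(s * (n * (δ / 4))) + n * (s ^ 2 * C) ≤ _
        have h1 : n * (s * (s * C)) ≤ n * (s * (δ / 8)) := by gcongr
        have h2 : n * (s ^ 2 * C) = n * (s * (s * C)) := by ring
        have h3 : s * (n * (δ / 4)) = 2 * (n * (s * (δ / 8))) := by ring
        linarith)
    rw [show n * (R + δ / 4) + n * (δ / 4) = n * (R + δ / 2) by ring] at h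
    rw [div_mul_eq_mul_div, le_div_iff₀ hε]
    linarith
  -- The count forced by the rate `R + δ` loses only a polynomial factor, while the strong converse
  -- allows rate `R + δ / 2`.
  have contra : ∀ N g R : ℝ, Real.exp (n * (R + δ)) ≤ N → N ≤ 2 * (n + 1 : ℝ) ^ J * g →
      g ≤ 2 / ε * Real.exp (n * (R + δ / 2)) → False := by
    intro N g R h1 h2 h3
    have h4 : Real.exp (n * (R + δ)) = Real.exp (n * (δ / 2)) * Real.exp (n * (R + δ / 2)) := by
      rw [← Real.exp_add]; ring_nf
    have h5 : 2 * (n + 1 : ℝ) ^ J * g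
        ≤ 2 * (n + 1 : ℝ) ^ J * (2 / ε * Real.exp (n * (R + δ / 2))) := by gcongr
    have h6 := mul_lt_mul_of_pos_right hnJ (Real.exp_pos (n * (R + δ / 2)))
    have h7 : 2 * (n + 1 : ℝ) ^ J * (2 / ε * Real.exp (n * (R + δ / 2)))
        = 2 * (2 / ε) * (n + 1 : ℝ) ^ J * Real.exp (n * (R + δ / 2)) := by ring
    linarith
  rcases hcases with ⟨hR, hq⟩ | ⟨hR, hq⟩ | ⟨hR, hq⟩
  · obtain ⟨j, hj⟩ := exists_le_card_mul_card_filter G Prod.snd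
    refine contra _ _ RX hι ?_ (strong (G.filter fun p => p.2 = j) (filter_subset _ _)
      (fun t => Q (u t, x p₀.1 t, y j t)) ?_ RX hR)
    · have hj' : (#G : ℝ) ≤ Fintype.card κ * #(G.filter fun p => p.2 = j) := by exact_mod_cast hj
      have : 2 * (n + 1 : ℝ) ^ J * #G
          ≤ 2 * (n + 1 : ℝ) ^ J * (Fintype.card κ * #(G.filter fun p => p.2 = j)) := by gcongr
      refine le_of_mul_le_mul_right ?_ hκ0
      linarith
    · intro p hp t
      rw [← (mem_filter.1 hp).2]
      exact hq _ _ _ _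
  · obtain ⟨i, hi⟩ := exists_le_card_mul_card_filter G Prod.fst
    refine contra _ _ RY hκ ?_ (strong (G.filter fun p => p.1 = i) (filter_subset _ _)
      (fun t => Q (u t, x i t, y p₀.2 t)) ?_ RY hR)
    · have hi' : (#G : ℝ) ≤ Fintype.card ι * #(G.filter fun p => p.1 = i) := by exact_mod_cast hi
      have : 2 * (n + 1 : ℝ) ^ J * #G
          ≤ 2 * (n + 1 : ℝ) ^ J * (Fintype.card ι * #(G.filter fun p => p.1 = i)) := by gcongr
      refine le_of_mul_le_mul_left ?_ hι0
      linarith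
    · intro p hp t
      rw [← (mem_filter.1 hp).2]
      exact hq _ _ _ _
  · refine contra _ _ (RX + RY) ?_ hGcard (strong G subset_rfl
      (fun t => Q (u t, x p₀.1 t, y p₀.2 t)) (fun p _ t => hq _ _ _ _ _) (RX + RY) hR)
    refine le_trans ?_ (mul_le_mul hι hκ (Real.exp_pos _).le hι0.le)
    rw [← Real.exp_add]
    refine Real.exp_le_exp.2 ?_
    have := mul_pos hn0 hδ
    linarith

/-! ### From the maximal to the average error. -/

/-- If every large rectangle contains an entry that is at least `θ`, then the sum of all entries
is large. -/
theorem div_mul_mul_le_sum_sum {M N a b : ℕ} {f : Fin M → Fin N → ℝ} (hf : ∀ i j, 0 ≤ f i j) {θ : ℝ}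
    (hθ : 0 ≤ θ) (h : ∀ g : Fin a → Fin M, Function.Injective g → ∀ B : Finset (Fin N), b ≤ #B →
      ∃ s, ∃ j ∈ B, θ ≤ f (g s) j) :
    ((M / a : ℕ) : ℝ) * ((N - b) * θ) ≤ ∑ i, ∑ j, f i j := by
  classical
  have row : ∀ g : Fin a → Fin M, Function.Injective g → (N - b) * θ ≤ ∑ s, ∑ j, f (g s) j := by
    intro g hg
    -- Columns without an entry of size `θ` in the chosen rows form a rectangle without such
    -- entries, so there are fewer than `b` of them.
    set B : Finset (Fin N) := univ.filter fun j => ∀ s, f (g s) j < θ with hB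
    have hBb : #B < b := by
      by_contra! hcon
      obtain ⟨s, j, hj, hle⟩ := h g hg B hcon
      exact absurd hle (not_le.2 ((mem_filter.1 hj).2 s))
    have hcard : (N : ℝ) - b ≤ #Bᶜ := by
      have h1 := card_add_card_compl B
      rw [Fintype.card_fin] at h1
      have h2 : (#B : ℝ) + #Bᶜ = N := by exact_mod_cast h1
      have h3 : (#B : ℝ) ≤ b := by exact_mod_cast hBb.le
      linarith
    rw [sum_comm]
    calc (N - b) * θ ≤ #Bᶜ * θ := mul_le_mul_of_nonneg_right hcard hθ
      _ = #Bᶜ • θ := (nsmul_eq_mul _ _).symm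
      _ ≤ ∑ j ∈ Bᶜ, ∑ s, f (g s) j := by
          refine card_nsmul_le_sum _ _ _ fun j hj => ?_
          simp only [hB, mem_compl, mem_filter, mem_univ, true_and, not_forall, not_lt] at hj
          obtain ⟨s, hs⟩ := hj
          exact hs.trans (single_le_sum (f := fun s => f (g s) j) (fun s _ => hf _ _) (mem_univ s))
      _ ≤ ∑ j, ∑ s, f (g s) j :=
          sum_le_sum_of_subset_of_nonneg (subset_univ _) fun j _ _ => sum_nonneg fun s _ => hf _ _
  -- Cuts the rows into `M / a` disjoint groups of `a`; leftover rows are dropped.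
  let emb : Fin (M / a) × Fin a ↪ Fin M :=
    finProdFinEquiv.toEmbedding.trans (Fin.castLEEmb (Nat.div_mul_le_self M a))
  calc ((M / a : ℕ) : ℝ) * ((N - b) * θ) = ∑ _r : Fin (M / a), (N - b) * θ := by simp
    _ ≤ ∑ r : Fin (M / a), ∑ s, ∑ j, f (emb (r, s)) j :=
        sum_le_sum fun r _ => row (fun s => emb (r, s)) fun s s' hs => by
          simpa using emb.injective hs
    _ = ∑ i ∈ univ.map emb, ∑ j, f i j := by rw [sum_map, Fintype.sum_prod_type]
    _ ≤ ∑ i, ∑ j, f i j :=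
        sum_le_sum_of_subset_of_nonneg (subset_univ _) fun i _ _ => sum_nonneg fun j _ => hf _ _

/-- At least `M / (2 * a)` groups of rows, each with at least `N / 2` bad columns, make the mean at
least `θ / (4 * a)`. The division by `a`, about `exp (n * R)`, is the price for averaging, and it
involves only the rate of the row user. -/
theorem half_exp_le_mean {M N n : ℕ} {R S δ ε e : ℝ} {f : Fin M → Fin N → ℝ}
    (hf : ∀ i j, 0 ≤ f i j) (hR : 0 < R) (hS : 0 < S) (hε : 0 < ε) (hεδ : ε ≤ δ) (hε1 : ε ≤ 1)
    (hεR : 6 * ε ≤ R * δ) (he : 0 ≤ e) (hn : 4 ≤ Real.exp (n * (δ - ε)))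
    (hn' : 4 ≤ Real.exp (n * (R * δ / 2)))
    (hM : Real.exp (n * (R + δ)) ≤ M) (hN : Real.exp (n * (S + δ)) ≤ N)
    (h : ∀ g : Fin ⌈Real.exp (n * (R + ε))⌉₊ → Fin M, Function.Injective g →
      ∀ B : Finset (Fin N), ⌈Real.exp (n * (S + ε))⌉₊ ≤ #B →
        ∃ s, ∃ j ∈ B, Real.exp (-(n * ((e + ε) * (1 + ε)))) ≤ f (g s) j) :
    1 / 2 * Real.exp (-(n * (e + R) * (1 + δ))) ≤ 1 / ((M : ℝ) * N) * ∑ i, ∑ j, f i j := by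
  have hsum := div_mul_mul_le_sum_sum hf (Real.exp_pos _).le h
  set θ := Real.exp (-(n * ((e + ε) * (1 + ε)))) with hθ
  have hn0 : (0 : ℝ) ≤ n := n.cast_nonneg
  have hceil : ∀ T : ℝ, 0 < T → (⌈Real.exp (n * (T + ε))⌉₊ : ℝ) ≤ 2 * Real.exp (n * (T + ε)) := by
    intro T hT
    have h1 := (Nat.ceil_lt_add_one (Real.exp_pos (n * (T + ε))).le).le
    have h2 : 1 ≤ Real.exp (n * (T + ε)) := Real.one_le_exp (by positivity)
    linarith
  have hlarge : ∀ T : ℝ, 4 * Real.exp (n * (T + ε)) ≤ Real.exp (n * (T + δ)) := by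
    intro T
    rw [show n * (T + δ) = n * (δ - ε) + n * (T + ε) by ring, Real.exp_add]
    exact mul_le_mul_of_nonneg_right hn (Real.exp_pos _).le
  set a := ⌈Real.exp (n * (R + ε))⌉₊ with ha
  set b := ⌈Real.exp (n * (S + ε))⌉₊ with hb
  have ha0 : 0 < a := Nat.ceil_pos.2 (Real.exp_pos _)
  have ha0' : (0 : ℝ) < a := by exact_mod_cast ha0
  have haM : a ≤ M := by
    have : (a : ℝ) ≤ M := by linarith [hceil R hR, hlarge R, Real.exp_pos (n * (R + ε))]
    exact_mod_cast this
  have hMpos : (0 : ℝ) < M := (Real.exp_pos _).trans_le hM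
  have hNpos : (0 : ℝ) < N := (Real.exp_pos _).trans_le hN
  have hbN : (N : ℝ) / 2 ≤ N - b := by
    have := hceil S hS
    have := hlarge S
    linarith
  have hq : (M : ℝ) / (2 * a) ≤ (M / a : ℕ) := by
    have h1 : M < a * (M / a + 1) := Nat.lt_mul_div_succ M ha0
    have h2 : 1 ≤ M / a := (Nat.one_le_div_iff ha0).2 haM
    have h3 : M ≤ (M / a) * (2 * a) := by nlinarith
    rw [div_le_iff₀ (by positivity)]
    exact_mod_cast h3
  have hθ0 : 0 < θ := Real.exp_pos _
  have h1 : (M : ℝ) / (2 * a) * (N / 2 * θ) ≤ ∑ i, ∑ j, f i j :=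
    (mul_le_mul hq (mul_le_mul_of_nonneg_right hbN hθ0.le) (by positivity)
      (by positivity)).trans hsum
  have h2 : θ / (4 * a) ≤ 1 / ((M : ℝ) * N) * ∑ i, ∑ j, f i j := by
    refine le_trans (le_of_eq ?_) (mul_le_mul_of_nonneg_left h1 (by positivity))
    field_simp
    ring
  refine le_trans ?_ h2
  rw [le_div_iff₀ (by positivity)]
  have h3 : Real.exp (-(n * (e + R) * (1 + δ))) * Real.exp (n * (R + ε)) *
      Real.exp (n * (R * δ / 2)) ≤ θ := by
    rw [hθ, ← Real.exp_add, ← Real.exp_add, Real.exp_le_exp]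
    -- `2 * ε + ε ^ 2 ≤ 3 * ε ≤ R * δ / 2`; the other half of `R * δ` absorbs the constant factor 4
    -- through `hn'`.
    have h4 : (e + ε) * (1 + ε) + (R + ε) + R * δ / 2 ≤ (e + R) * (1 + δ) := by nlinarith
    have := mul_le_mul_of_nonneg_left h4 hn0
    linarith
  have h5 := mul_le_mul_of_nonneg_left hn' (by positivity :
    0 ≤ Real.exp (-(n * (e + R) * (1 + δ))) * Real.exp (n * (R + ε)))
  have h6 := mul_le_mul_of_nonneg_left (hceil R hR) (Real.exp_pos (-(n * (e + R) * (1 + δ)))).le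
  linarith

theorem exp_le_of_le_log {M n : ℕ} {r : ℝ} (hn : 0 < n) (hr : 0 < r)
    (h : r ≤ 1 / (n : ℝ) * Real.log M) : Real.exp (n * r) ≤ M := by
  have hn0 : (0 : ℝ) < n := by exact_mod_cast hn
  have hM : (0 : ℝ) < M := by
    -- An empty message set is excluded because `Real.log 0 = 0` while `r > 0`.
    rcases Nat.eq_zero_or_pos M with rfl | hM
    · simp at h; linarith
    · exact_mod_cast hM
  rw [← Real.le_log_iff_exp_le hM]
  rw [one_div_mul_eq_div, le_div_iff₀ hn0] at h
  linarith

/-- The sphere-packing bound for the average error probability, in real numbers. -/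
theorem exists_half_exp_le_avgError {X Y Z : Type*} [Fintype X] [Fintype Y] [Fintype Z]
    [Nonempty X] [Nonempty Y] [Nonempty Z] {RX RY δ : ℝ} (hRX : 0 < RX) (hRY : 0 < RY)
    (hδ : 0 < δ) :
    ∃ n₀ : ℕ, 0 < n₀ ∧ ∀ W : X → Y → Z → ℝ, IsChannel W →
      ∀ n : ℕ, n₀ ≤ n → ∀ (MX MY : ℕ) (C : Code X Y Z n MX MY),
        RX + δ ≤ 1 / (n : ℝ) * Real.log (MX : ℝ) →
        RY + δ ≤ 1 / (n : ℝ) * Real.log (MY : ℝ) →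
        ∀ e : ℝ, 0 ≤ e → maxErrorSpherePackingExponent RX RY W ≤ ENNReal.ofReal e →
          1 / 2 * Real.exp (-(n * (e + min RX RY) * (1 + δ))) ≤ C.avgError W := by
  obtain ⟨ε, hε, hεδ, hε1, hεX, hεY⟩ : ∃ ε : ℝ, 0 < ε ∧ ε < δ ∧ ε ≤ 1 ∧ 6 * ε ≤ RX * δ ∧
      6 * ε ≤ RY * δ := by
    refine ⟨min (min (δ / 2) 1) (min (RX * δ / 6) (RY * δ / 6)), by positivity, ?_, ?_, ?_, ?_⟩
    · exact ((min_le_left _ _).trans (min_le_left _ _)).trans_lt (by linarith)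
    · exact (min_le_left _ _).trans (min_le_right _ _)
    · linarith [(min_le_right (min (δ / 2) 1) (min (RX * δ / 6) (RY * δ / 6))).trans (min_le_left _ _)]
    · linarith [(min_le_right (min (δ / 2) 1) (min (RX * δ / 6) (RY * δ / 6))).trans (min_le_right _ _)]
  obtain ⟨n₁, hn₁⟩ := exists_exp_le_blockProbSet_compl (X := X) (Y := Y) (Z := Z) RX RY hε
  have four : ∀ b : ℝ, 0 < b → ∀ᶠ n : ℕ in atTop, 4 ≤ Real.exp (n * b) := fun b hb => by
    filter_upwards [eventually_lt_mul hb (Real.log 4)] with n hn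
    rw [← Real.log_le_iff_le_exp (by norm_num)]
    exact hn.le
  obtain ⟨n₂, hn₂⟩ := eventually_atTop.1 ((four (δ - ε) (by linarith)).and
    ((four (RX * δ / 2) (by positivity)).and (four (RY * δ / 2) (by positivity))))
  refine ⟨max (max n₁ n₂) 1, by simp, fun W hW n hn MX MY C hX hY e he hE => ?_⟩
  obtain ⟨hn4, hn4X, hn4Y⟩ := hn₂ n ((le_max_right _ _).trans ((le_max_left _ _).trans hn))
  have hpack := hn₁ W hW n ((le_max_left _ _).trans ((le_max_left _ _).trans hn))
  have hnpos : 0 < n := (le_max_right _ _).trans hn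
  have hMX := exp_le_of_le_log hnpos (by linarith) hX
  have hMY := exp_le_of_le_log hnpos (by linarith) hY
  unfold Code.avgError
  rcases le_total RX RY with hle | hle
  · rw [min_eq_left hle]
    refine half_exp_le_mean (fun i j => blockProbSet_nonneg hW _ _ _) hRX hRY hε hεδ.le hε1 hεX he
      hn4 hn4X hMX hMY fun g hg B hB => ?_
    -- Any rectangle of codewords is itself a code with disjoint decoding sets, of rates at least
    -- `RX + ε` and `RY + ε`.
    obtain ⟨s, j, h⟩ := hpack (Fin ⌈Real.exp (n * (RX + ε))⌉₊) B (fun s => C.cwX (g s))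
      (fun j => C.cwY j) (fun s j => C.dec (g s) j)
      (fun s j s' j' hne => C.dec_disjoint _ _ _ _ fun h => hne (by
        rw [Prod.mk.injEq] at h ⊢
        exact ⟨hg h.1, Subtype.ext h.2⟩))
      (by rw [Fintype.card_fin]; exact Nat.le_ceil _)
      (by rw [Fintype.card_coe]; exact (Nat.le_ceil _).trans (by exact_mod_cast hB)) e he hE
    exact ⟨s, j, j.2, h⟩
  -- The smaller rate now belongs to `Y`, so the error matrix is transposed and the `y`-codewords
  -- become the rows.
  · rw [min_eq_right hle, mul_comm (MX : ℝ), sum_comm]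
    refine half_exp_le_mean (f := fun j i => blockProbSet W (C.cwX i) (C.cwY j) (C.dec i j)ᶜ)
      (fun i j => blockProbSet_nonneg hW _ _ _) hRY hRX hε hεδ.le hε1 hεY he
      hn4 hn4Y hMY hMX fun g hg B hB => ?_
    obtain ⟨i, s, h⟩ := hpack B (Fin ⌈Real.exp (n * (RY + ε))⌉₊) (fun i => C.cwX i)
      (fun s => C.cwY (g s)) (fun i s => C.dec i (g s))
      (fun i s i' s' hne => C.dec_disjoint _ _ _ _ fun h => hne (by
        rw [Prod.mk.injEq] at h ⊢
        exact ⟨Subtype.ext h.1, hg h.2⟩))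
      (by rw [Fintype.card_coe]; exact (Nat.le_ceil _).trans (by exact_mod_cast hB))
      (by rw [Fintype.card_fin]; exact Nat.le_ceil _) e he hE
    exact ⟨s, i, i.2, h⟩

end MAC

theorem mainTheorem4 {X Y Z : Type*} [Fintype X] [Fintype Y] [Fintype Z]
    [Nonempty X] [Nonempty Y] [Nonempty Z]
    (RX RY δ : ℝ) (hRX : 0 < RX) (hRY : 0 < RY) (hδ : 0 < δ) :
    ∃ n₀ : ℕ, ∀ W : X → Y → Z → ℝ, MAC.IsChannel W →
      ∀ n : ℕ, n₀ ≤ n → ∀ (MX MY : ℕ) (C : MAC.Code X Y Z n MX MY),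
        RX + δ ≤ 1 / (n : ℝ) * Real.log (MX : ℝ) →
        RY + δ ≤ 1 / (n : ℝ) * Real.log (MY : ℝ) →
        1 / 2 * EReal.exp
            (-((n : EReal) *
                ((MAC.maxErrorSpherePackingExponent RX RY W : EReal) + ((min RX RY : ℝ) : EReal)) *
                ((1 + δ : ℝ) : EReal)))
          ≤ ENNReal.ofReal (C.avgError W) := by
  obtain ⟨n₀, hn₀, h⟩ := MAC.exists_half_exp_le_avgError (X := X) (Y := Y) (Z := Z) hRX hRY hδ
  refine ⟨n₀, fun W hW n hn MX MY C hX hY => ?_⟩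
  rcases eq_or_ne (MAC.maxErrorSpherePackingExponent RX RY W) ⊤ with hE | hE
  -- Positivity of `n₀` matters here: `0 * ⊤ = 0` in `EReal`, so for `n = 0` the exponential would
  -- not vanish.
  · have hn0 : (0 : EReal) < n := by exact_mod_cast hn₀.trans_le hn
    have hδ1 : (0 : EReal) < ((1 + δ : ℝ) : EReal) := by exact_mod_cast (by linarith : 0 < 1 + δ)
    rw [hE, EReal.coe_ennreal_top, EReal.top_add_coe, EReal.mul_top_of_pos hn0,
      EReal.top_mul_of_pos hδ1, EReal.neg_top, EReal.exp_bot, mul_zero]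
    exact zero_le
  · have hEe := (ENNReal.ofReal_toReal hE).symm
    set e := (MAC.maxErrorSpherePackingExponent RX RY W).toReal
    have he : 0 ≤ e := ENNReal.toReal_nonneg
    have hle := h W hW n hn MX MY C hX hY e he hEe.le
    have hexp : (n : EReal) * ((MAC.maxErrorSpherePackingExponent RX RY W : EReal) +
        ((min RX RY : ℝ) : EReal)) * ((1 + δ : ℝ) : EReal)
        = ((n * (e + min RX RY) * (1 + δ) : ℝ) : EReal) := by
      rw [hEe, EReal.coe_ennreal_ofReal, max_eq_left he, ← EReal.coe_natCast]
      simp only [EReal.coe_mul, EReal.coe_add]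
    rw [hexp, ← EReal.coe_neg, EReal.exp_coe]
    refine le_trans (le_of_eq ?_) (ENNReal.ofReal_le_ofReal hle)
    rw [ENNReal.ofReal_mul (by norm_num), ENNReal.ofReal_div_of_pos two_pos, ENNReal.ofReal_one,
      ENNReal.ofReal_ofNat]
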